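/- Let $G(n,p)$ denote the binomial random graph on $n$ labelled vertices, in which each pair of vertices is an edge independently with probability $p$; $\log$ is the natural logarithm. A linear forest is a graph each of whose connected components is a path, and the order of a graph is its number of vertices. For every $\varepsilon>0$ there exists $d_0>0$ such that the following holds. Let $p=p(n)\in[0,1]$ be any sequence and put $d=d(n)=np$; suppose that $d_0\le d\le n^{1/2}\log^2 n$ for all sufficiently large $n$. Then, with probability tending to $1$ as $n\to\infty$, $G(n,p)$ contains an induced subgraph which is a linear forest of order at least $(2-\varepsilon)\,p^{-1}\log(np)$ and every component of which is a path of order exactly $\lfloor d^{1/2}/\log^4 d\rfloor$. -/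

import Mathlib

/-- A graph is a linear forest if each of its connected components is a path, that is, isomorphic
to the path graph on `k` vertices for some `k`. (Such a graph is automatically acyclic.) -/
def IsLinearForest {V : Type*} (H : SimpleGraph V) : Prop :=
  ∀ C : H.ConnectedComponent, ∃ k : ℕ, Nonempty (C.toSimpleGraph ≃g SimpleGraph.pathGraph k)

/-- `G` contains an induced linear forest which has at least `m` vertices in total and all of whose
component paths have exactly `L` vertices. -/
def HasInducedLinearForest {V : Type*} [Fintype V] (G : SimpleGraph V) (m : ℝ) (L : ℕ) : Prop :=
  ∃ U : Finset V, m ≤ (U.card : ℝ) ∧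
    IsLinearForest (G.induce (U : Set V)) ∧
    ∀ C : (G.induce (U : Set V)).ConnectedComponent, C.supp.ncard = L

open Finset MeasureTheory Filter

/-! ### A finite model of the binomial random graph -/

namespace SimpleGraph

/-- The mass given by a Bernoulli variable of parameter `p` to a truth value. -/
def bernoulliWeight (p : ℝ) (b : Bool) : ℝ := if b then p else 1 - p

lemma bernoulliWeight_nonneg {p : ℝ} (h0 : 0 ≤ p) (h1 : p ≤ 1) (b : Bool) :
    0 ≤ bernoulliWeight p b := by
  unfold bernoulliWeight; split_ifs <;> linarith

lemma sum_bernoulliWeight (p : ℝ) : ∑ b, bernoulliWeight p b = 1 := by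
  simp [bernoulliWeight]

/-- The possible edges of a graph on `V`. -/
abbrev Edge (V : Type*) := {e : Sym2 V // ¬ e.IsDiag}

/-- The graph whose edges are the pairs that `ω` selects. -/
def graphOf {V : Type*} (ω : Edge V → Bool) : SimpleGraph V :=
  fromEdgeSet {e | ∃ h : ¬ e.IsDiag, ω ⟨e, h⟩ = true}

lemma mem_edgeSet_graphOf {V : Type*} (ω : Edge V → Bool) (e : Sym2 V) :
    e ∈ (graphOf ω).edgeSet ↔ ∃ h : ¬ e.IsDiag, ω ⟨e, h⟩ = true := by
  simp only [graphOf, edgeSet_fromEdgeSet, Set.mem_sdiff, Set.mem_ofPred_eq, Sym2.mem_diagSet]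
  exact ⟨fun h => h.1, fun h => ⟨h, h.1⟩⟩

lemma graphOf_bijective (V : Type*) :
    Function.Bijective (graphOf : (Edge V → Bool) → SimpleGraph V) := by
  classical
  constructor
  · intro ω ω' h
    funext e
    have h1 := mem_edgeSet_graphOf ω e.1
    rw [h, mem_edgeSet_graphOf] at h1
    simp only [Subtype.coe_eta, e.2, not_false_eq_true, exists_true_left] at h1
    exact (Bool.eq_iff_iff.2 h1).symm
  · intro G
    refine ⟨fun e => decide (e.1 ∈ G.edgeSet), ?_⟩
    apply edgeSet_injective
    ext e
    rw [mem_edgeSet_graphOf]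
    simp only [decide_eq_true_eq, exists_prop, and_iff_right_iff_imp]
    exact fun h => G.not_isDiag_of_mem_edgeSet h

instance {V : Type*} [Finite V] : MeasurableSingletonClass (SimpleGraph V) where
  measurableSet_singleton G := by
    have h : ({G} : Set (SimpleGraph V)) = edgeSet ⁻¹' {G.edgeSet} := by
      ext H; simp
    rw [h]
    exact measurable_edgeSet (measurableSet_singleton _)

variable {V : Type*} [Fintype V] [DecidableEq V]

lemma binomialRandom_real_singleton_graphOf (p : unitInterval) (ω : Edge V → Bool) :
    (binomialRandom V p).real {graphOf ω} = ∏ e, bernoulliWeight p (ω e) := by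
  have hcard : (graphOf ω).edgeSet.ncard = (univ.filter fun e => ω e = true).card := by
    have : (graphOf ω).edgeSet = ((univ.filter fun e => ω e = true).image Subtype.val :
        Finset (Sym2 V)) := by
      ext e
      simp [mem_edgeSet_graphOf]
    rw [this, Set.ncard_coe_finset, card_image_of_injective _ Subtype.val_injective]
  have htot : (univ.filter fun e => ω e = true).card + (univ.filter fun e => ¬ ω e = true).card
      = (Nat.card V).choose 2 := by
    rw [card_filter_add_card_filter_not, Nat.card_eq_fintype_card, ← Sym2.card_subtype_not_diag,
      Finset.card_univ]
  rw [measureReal_def, binomialRandom_singleton, hcard, ← htot, Nat.add_sub_cancel_left]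
  simp only [bernoulliWeight]
  rw [prod_ite, prod_const, prod_const]
  simp

/-- Probabilities in the binomial random graph as sums over the outcomes of the edges. -/
lemma binomialRandom_real_eq_sum (p : unitInterval) (S : Set (SimpleGraph V)) :
    (binomialRandom V p).real S =
      ∑ ω : Edge V → Bool, (∏ e, bernoulliWeight p (ω e)) * S.indicator 1 (graphOf ω) := by
  classical
  have h1 : (binomialRandom V p).real S
      = ∑ G : SimpleGraph V, (binomialRandom V p).real {G} * S.indicator 1 G := by
    have : S = ((univ.filter fun G => G ∈ S : Finset (SimpleGraph V)) : Set (SimpleGraph V)) := by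
      ext; simp
    conv_lhs => rw [this]
    rw [← sum_measureReal_singleton, sum_filter]
    refine sum_congr rfl fun G _ => ?_
    by_cases h : G ∈ S <;> simp [h]
  rw [h1, ← (graphOf_bijective V).sum_comp]
  exact sum_congr rfl fun ω _ => by rw [binomialRandom_real_singleton_graphOf]

/-- The probability that the pairs in `A` are edges and those in `A'` are not. -/
lemma binomialRandom_real_cylinder (p : unitInterval) (A A' : Finset (Sym2 V))
    (hA : ∀ e ∈ A, ¬ e.IsDiag) (hA' : ∀ e ∈ A', ¬ e.IsDiag) (hd : Disjoint A A') :
    (binomialRandom V p).real {G | (∀ e ∈ A, e ∈ G.edgeSet) ∧ ∀ e ∈ A', e ∉ G.edgeSet} =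
      (p : ℝ) ^ A.card * (1 - (p : ℝ)) ^ A'.card := by
  classical
  -- The event is a conjunction of conditions on single edges, so its indicator is a product and the
  -- sum over outcomes factorises.
  let c : Edge V → Bool → ℝ := fun e b =>
    if (e.1 ∈ A → b = true) ∧ (e.1 ∈ A' → b = false) then 1 else 0
  have h1 : ∀ ω : Edge V → Bool,
      ({G : SimpleGraph V | (∀ e ∈ A, e ∈ G.edgeSet) ∧ ∀ e ∈ A', e ∉ G.edgeSet}).indicator
        (1 : SimpleGraph V → ℝ) (graphOf ω) = ∏ e, c e (ω e) := by
    intro ω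
    rw [prod_ite_zero]
    simp only [Set.indicator_apply, Set.mem_ofPred_eq, mem_edgeSet_graphOf, Pi.one_apply,
      prod_const_one]
    congr 1
    apply propext
    constructor
    · rintro ⟨h, h'⟩ e -
      refine ⟨fun he => (h _ he).2, fun he => ?_⟩
      have := h' _ he
      simpa [e.2] using this
    · intro h
      refine ⟨fun e he => ⟨hA e he, (h ⟨e, hA e he⟩ (mem_univ _)).1 he⟩, fun e he ⟨h1, h2⟩ => ?_⟩
      have := (h ⟨e, h1⟩ (mem_univ _)).2 he
      simp [h2] at this
  rw [binomialRandom_real_eq_sum]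
  simp_rw [h1, ← prod_mul_distrib]
  have h2 := Finset.prod_univ_sum (fun _ : Edge V => (univ : Finset Bool))
    (fun e b => bernoulliWeight p b * c e b)
  rw [Fintype.piFinset_univ] at h2
  rw [← h2]
  have h3 : ∀ e : Edge V, ∑ b, bernoulliWeight p b * c e b =
      (if e.1 ∈ A then (p : ℝ) else 1) * (if e.1 ∈ A' then 1 - (p : ℝ) else 1) := by
    intro e
    have : ¬ (e.1 ∈ A ∧ e.1 ∈ A') := fun h => (Finset.disjoint_left.1 hd) h.1 h.2
    by_cases ha : e.1 ∈ A <;> by_cases hb : e.1 ∈ A' <;> simp [bernoulliWeight, c, ha, hb]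
    exact (this ⟨ha, hb⟩).elim
  simp_rw [h3]
  rw [prod_mul_distrib]
  have h4 : ∀ (B : Finset (Sym2 V)) (x : ℝ), (∀ e ∈ B, ¬ e.IsDiag) →
      ∏ e : Edge V, (if e.1 ∈ B then x else 1) = x ^ B.card := by
    intro B x hB
    rw [prod_ite, prod_const, prod_const_one, mul_one]
    congr 1
    rw [← card_image_of_injective _ Subtype.val_injective]
    congr 1
    ext e
    simp only [mem_image, mem_filter, mem_univ, true_and, Subtype.exists, exists_and_right,
      exists_eq_right]
    exact ⟨fun h => h.2, fun h => ⟨hB e h, h⟩⟩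
  rw [h4 A _ hA, h4 A' _ hA']

end SimpleGraph

/-! ### Bounded differences without the mean -/

/-- The convex function x + 1/x is largest at the endpoints of the interval; the difference factors
through (eˡ - x)(x eˡ - 1). -/
lemma add_inv_le_exp_add_exp_neg {x l : ℝ} (h1 : Real.exp (-l) ≤ x) (h2 : x ≤ Real.exp l) :
    x + x⁻¹ ≤ 2 * Real.cosh l := by
  have hx : 0 < x := (Real.exp_pos _).trans_le h1
  have hy : 0 < Real.exp l := Real.exp_pos _
  rw [Real.exp_neg, inv_le_iff_one_le_mul₀ hy] at h1
  rw [Real.cosh_eq, Real.exp_neg]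
  have key : 0 ≤ (Real.exp l - x) * (x * Real.exp l - 1) :=
    mul_nonneg (by linarith) (by linarith)
  have : Real.exp l + (Real.exp l)⁻¹ - (x + x⁻¹) =
      (Real.exp l - x) * (x * Real.exp l - 1) / (x * Real.exp l) := by
    field_simp; ring
  have h3 : 0 ≤ Real.exp l + (Real.exp l)⁻¹ - (x + x⁻¹) := by
    rw [this]; positivity
  linarith

/-- Expanding the product and symmetrising in (a, b) leaves averages of r + 1/r with r = G a / G b
between e⁻ˡ and eˡ. -/
lemma sum_mul_sum_inv_le_cosh {α : Type*} [Fintype α] (w G : α → ℝ) (hw : ∀ a, 0 ≤ w a)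
    (hw1 : ∑ a, w a = 1) (hG : ∀ a, 0 < G a) {l : ℝ} (hGl : ∀ a b, G a ≤ Real.exp l * G b) :
    (∑ a, w a * G a) * ∑ b, w b * (G b)⁻¹ ≤ Real.cosh l := by
  have h1 : (∑ a, w a * G a) * ∑ b, w b * (G b)⁻¹ = ∑ a, ∑ b, w a * w b * (G a / G b) := by
    rw [sum_mul_sum]
    exact sum_congr rfl fun a _ => sum_congr rfl fun b _ => by rw [div_eq_mul_inv]; ring
  have h2 : ∑ a, ∑ b, w a * w b * (G a / G b) = ∑ a, ∑ b, w a * w b * (G b / G a) := by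
    rw [sum_comm]
    exact sum_congr rfl fun a _ => sum_congr rfl fun b _ => by ring
  have h3 : ∑ a, ∑ b, w a * w b * (G a / G b) + ∑ a, ∑ b, w a * w b * (G b / G a) ≤
      2 * Real.cosh l := by
    calc _ = ∑ a, ∑ b, w a * w b * (G a / G b + (G a / G b)⁻¹) := by
          simp_rw [← sum_add_distrib]
          exact sum_congr rfl fun a _ => sum_congr rfl fun b _ => by rw [inv_div]; ring
      _ ≤ ∑ a, ∑ b, w a * w b * (2 * Real.cosh l) := by
          refine sum_le_sum fun a _ => sum_le_sum fun b _ => ?_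
          refine mul_le_mul_of_nonneg_left ?_ (mul_nonneg (hw a) (hw b))
          apply add_inv_le_exp_add_exp_neg
          · rw [le_div_iff₀ (hG b), Real.exp_neg, inv_mul_le_iff₀ (Real.exp_pos _)]
            exact hGl b a
          · rw [div_le_iff₀ (hG b)]
            exact hGl a b
      _ = 2 * Real.cosh l := by
          simp_rw [← sum_mul, ← mul_sum, ← sum_mul, hw1]
          ring
  rw [h1]
  linarith

lemma sum_prod_weight_eq_one {n : ℕ} {Ω : Fin n → Type*} [∀ j, Fintype (Ω j)]
    (w : ∀ j, Ω j → ℝ) (hw1 : ∀ j, ∑ a, w j a = 1) :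
    ∑ x : ∀ j, Ω j, ∏ j, w j (x j) = 1 := by
  have h := Finset.prod_univ_sum (fun j => (univ : Finset (Ω j))) w
  rw [Fintype.piFinset_univ] at h
  rw [← h]
  simp [hw1]

/-- Exponential moments of a function on a product of `n` probability spaces that changes by at
most `1` when one coordinate changes. -/
theorem mul_exp_moments_le {n : ℕ} : ∀ {Ω : Fin n → Type} [∀ j, Fintype (Ω j)]
    (w : ∀ j, Ω j → ℝ), (∀ j a, 0 ≤ w j a) → (∀ j, ∑ a, w j a = 1) →
    ∀ (f : (∀ j, Ω j) → ℝ), (∀ j x y, (∀ i, i ≠ j → x i = y i) → f x ≤ f y + 1) →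
    ∀ {l : ℝ}, 0 ≤ l →
    (∑ x, (∏ j, w j (x j)) * Real.exp (l * f x)) *
      (∑ x, (∏ j, w j (x j)) * Real.exp (-(l * f x))) ≤ Real.cosh l ^ n := by
  induction n with
  | zero =>
    intro Ω _ w _ _ f _ l _
    simp [← Real.exp_add]
  | succ n ih =>
    intro Ω _ w hw hw1 f hf l hl
    have hsplit : ∀ F : (∀ j, Ω j) → ℝ, ∑ x, (∏ j, w j (x j)) * F x =
        ∑ a, w 0 a * ∑ y : ∀ j : Fin n, Ω j.succ, (∏ j, w j.succ (y j)) * F (Fin.cons a y) := by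
      intro F
      rw [← (Fin.consEquiv Ω).sum_comp, Fintype.sum_prod_type]
      refine sum_congr rfl fun a _ => ?_
      rw [mul_sum]
      refine sum_congr rfl fun y _ => ?_
      rw [show Fin.consEquiv Ω (a, y) = Fin.cons a y from rfl, Fin.prod_univ_succ]
      simp [mul_assoc]
    rw [hsplit, hsplit]
    -- `G` and `H` are the two exponential moments conditioned on the first coordinate. Induction
    -- bounds `H a` by a multiple of 1 / `G a`, and one more coordinate costs one factor cosh l.
    set G : Ω 0 → ℝ := fun a => ∑ y : ∀ j : Fin n, Ω j.succ, (∏ j, w j.succ (y j)) *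
      Real.exp (l * f (Fin.cons a y)) with hGdef
    set H : Ω 0 → ℝ := fun a => ∑ y : ∀ j : Fin n, Ω j.succ, (∏ j, w j.succ (y j)) *
      Real.exp (-(l * f (Fin.cons a y))) with hHdef
    have hprod : ∀ y : ∀ j : Fin n, Ω j.succ, 0 ≤ ∏ j, w j.succ (y j) := fun y =>
      prod_nonneg fun j _ => hw _ _
    have hGpos : ∀ a, 0 < G a := by
      intro a
      have h1 : ∑ y : ∀ j : Fin n, Ω j.succ, ∏ j, w j.succ (y j) ≠ 0 := by
        rw [sum_prod_weight_eq_one (fun j : Fin n => w j.succ) fun j => hw1 _]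
        exact one_ne_zero
      obtain ⟨y, -, hy⟩ := exists_ne_zero_of_sum_ne_zero h1
      exact sum_pos' (fun y _ => mul_nonneg (hprod y) (Real.exp_pos _).le)
        ⟨y, mem_univ _, mul_pos ((hprod y).lt_of_ne' hy) (Real.exp_pos _)⟩
    have hGl : ∀ a b, G a ≤ Real.exp l * G b := by
      intro a b
      simp only [hGdef]
      rw [mul_sum]
      refine sum_le_sum fun y _ => ?_
      rw [mul_left_comm, ← Real.exp_add]
      refine mul_le_mul_of_nonneg_left (Real.exp_le_exp.2 ?_) (hprod y)
      have : f (Fin.cons a y) ≤ f (Fin.cons b y) + 1 := by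
        refine hf 0 _ _ fun i hi => ?_
        obtain ⟨j, rfl⟩ := Fin.exists_succ_eq.2 hi
        simp
      nlinarith
    have hGH : ∀ a, H a ≤ Real.cosh l ^ n * (G a)⁻¹ := by
      intro a
      rw [← div_eq_mul_inv, le_div_iff₀ (hGpos a), mul_comm]
      refine ih (fun j => w j.succ) (fun j => hw _) (fun j => hw1 _)
        (fun y => f (Fin.cons a y)) (fun j x y hxy => ?_) hl
      refine hf j.succ _ _ fun i hi => ?_
      induction i using Fin.cases with
      | zero => simp
      | succ i => simpa using hxy i fun h => hi (by rw [h])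
    have hc : 0 ≤ Real.cosh l := (Real.cosh_pos l).le
    calc (∑ a, w 0 a * G a) * ∑ a, w 0 a * H a
        ≤ (∑ a, w 0 a * G a) * ∑ a, w 0 a * (Real.cosh l ^ n * (G a)⁻¹) := by
          refine mul_le_mul_of_nonneg_left (sum_le_sum fun a _ =>
            mul_le_mul_of_nonneg_left (hGH a) (hw 0 a)) ?_
          exact sum_nonneg fun a _ => mul_nonneg (hw 0 a) (hGpos a).le
      _ = Real.cosh l ^ n * ((∑ a, w 0 a * G a) * ∑ a, w 0 a * (G a)⁻¹) := by
          rw [mul_left_comm, mul_sum univ _ (Real.cosh l ^ n)]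
          congr 1
          exact sum_congr rfl fun a _ => by ring
      _ ≤ Real.cosh l ^ n * Real.cosh l :=
          mul_le_mul_of_nonneg_left (sum_mul_sum_inv_le_cosh _ _ (hw 0) (hw1 0) hGpos hGl)
            (pow_nonneg hc n)
      _ = Real.cosh l ^ (n + 1) := (pow_succ _ _).symm

/-- The same for functions of independent truth values that are revealed in `n` groups. -/
theorem mul_exp_moments_le_of_groups {ι : Type} [Fintype ι] [DecidableEq ι] {n : ℕ}
    (g : ι → Fin n)
    (w : Bool → ℝ) (hw : ∀ b, 0 ≤ w b) (hw1 : ∑ b, w b = 1) (f : (ι → Bool) → ℝ)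
    (hf : ∀ j x y, (∀ i, g i ≠ j → x i = y i) → f x ≤ f y + 1) {l : ℝ} (hl : 0 ≤ l) :
    (∑ x, (∏ i, w (x i)) * Real.exp (l * f x)) *
      (∑ x, (∏ i, w (x i)) * Real.exp (-(l * f x))) ≤ Real.cosh l ^ n := by
  classical
  let e : (∀ j : Fin n, {i // g i = j} → Bool) ≃ (ι → Bool) :=
    (Equiv.piCurry fun (j : Fin n) (_ : {i // g i = j}) => Bool).symm.trans
      ((Equiv.sigmaFiberEquiv g).arrowCongr (Equiv.refl Bool))
  have he : ∀ x i, e x i = x (g i) ⟨i, rfl⟩ := fun x i => rfl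
  have hprod : ∀ x, ∏ i, w (e x i) = ∏ j, ∏ i : {i // g i = j}, w (x j i) := by
    intro x
    rw [← Fintype.prod_fiberwise g]
    refine prod_congr rfl fun j _ => prod_congr rfl fun i _ => ?_
    obtain ⟨i, rfl⟩ := i
    rw [he]
  have hsum : ∀ j, ∑ a : {i // g i = j} → Bool, ∏ i, w (a i) = 1 := by
    intro j
    have h := Finset.prod_univ_sum (fun _ : {i // g i = j} => (univ : Finset Bool))
      (fun _ b => w b)
    rw [Fintype.piFinset_univ] at h
    rw [← h, hw1, prod_const_one]
  have key := mul_exp_moments_le (fun j (a : {i // g i = j} → Bool) => ∏ i, w (a i))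
    (fun j a => prod_nonneg fun i _ => hw _) hsum (fun x => f (e x)) (fun j x y hxy => by
      refine hf j _ _ fun i hi => ?_
      rw [he, he, hxy _ hi]) hl
  simp_rw [← hprod] at key
  rw [e.sum_comp fun x => (∏ i, w (x i)) * Real.exp (l * f x),
    e.sum_comp fun x => (∏ i, w (x i)) * Real.exp (-(l * f x))] at key
  exact key

/-- If `f` depends on the edges in groups with bounded differences, then it cannot both exceed `a`
and fall below `a - t` with large probabilities. -/
theorem SimpleGraph.binomialRandom_bounded_differences {V : Type} [Fintype V] [DecidableEq V]
    (p : unitInterval) {n : ℕ} (g : Sym2 V → Fin n) (f : SimpleGraph V → ℝ)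
    (hf : ∀ j (G G' : SimpleGraph V),
      (∀ e, g e ≠ j → (e ∈ G.edgeSet ↔ e ∈ G'.edgeSet)) → f G ≤ f G' + 1)
    {a t : ℝ} (hn : 0 < n) (ht : 0 ≤ t) :
    (binomialRandom V p).real {G | a ≤ f G} * (binomialRandom V p).real {G | f G ≤ a - t} ≤
      Real.exp (-(t ^ 2 / (2 * n))) := by
  classical
  -- This value minimises -lt + nl²/2, the exponent left after Markov's inequality for both tails
  -- and cosh l ≤ exp(l²/2).
  set l : ℝ := t / n with hl
  have hn' : (0 : ℝ) < n := by exact_mod_cast hn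
  have hl0 : 0 ≤ l := by positivity
  have hp0 := p.2.1
  have hp1 := p.2.2
  have hW : ∀ ω : Edge V → Bool, 0 ≤ ∏ e, bernoulliWeight p (ω e) := fun ω =>
    prod_nonneg fun e _ => bernoulliWeight_nonneg hp0 hp1 _
  have key := mul_exp_moments_le_of_groups (fun e : Edge V => g e.1) (bernoulliWeight p)
    (bernoulliWeight_nonneg hp0 hp1) (sum_bernoulliWeight p) (fun ω => f (graphOf ω))
    (fun j x y hxy => hf j _ _ fun e he => by
      simp only [mem_edgeSet_graphOf]
      exact exists_congr fun h => by rw [hxy ⟨e, h⟩ he]) hl0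
  have h1 : Real.exp (l * a) * (binomialRandom V p).real {G | a ≤ f G} ≤
      ∑ ω : Edge V → Bool, (∏ e, bernoulliWeight p (ω e)) * Real.exp (l * f (graphOf ω)) := by
    rw [binomialRandom_real_eq_sum, mul_sum]
    refine sum_le_sum fun ω _ => ?_
    rw [mul_left_comm]
    refine mul_le_mul_of_nonneg_left ?_ (hW ω)
    by_cases h : a ≤ f (graphOf ω)
    · simp only [Set.indicator_apply, Set.mem_ofPred_eq, h, if_true, Pi.one_apply, mul_one]
      exact Real.exp_le_exp.2 (by gcongr)
    · simp only [Set.indicator_apply, Set.mem_ofPred_eq, h, if_false, mul_zero]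
      positivity
  have h2 : Real.exp (-(l * (a - t))) * (binomialRandom V p).real {G | f G ≤ a - t} ≤
      ∑ ω : Edge V → Bool, (∏ e, bernoulliWeight p (ω e)) * Real.exp (-(l * f (graphOf ω))) := by
    rw [binomialRandom_real_eq_sum, mul_sum]
    refine sum_le_sum fun ω _ => ?_
    rw [mul_left_comm]
    refine mul_le_mul_of_nonneg_left ?_ (hW ω)
    by_cases h : f (graphOf ω) ≤ a - t
    · simp only [Set.indicator_apply, Set.mem_ofPred_eq, h, if_true, Pi.one_apply, mul_one]
      exact Real.exp_le_exp.2 (by gcongr)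
    · simp only [Set.indicator_apply, Set.mem_ofPred_eq, h, if_false, mul_zero]
      positivity
  have h3 : Real.cosh l ^ n ≤ Real.exp (n * (l ^ 2 / 2)) := by
    rw [Real.exp_nat_mul]
    exact pow_le_pow_left₀ (Real.cosh_pos l).le (Real.cosh_le_exp_half_sq l) n
  have h4 := (mul_le_mul h1 h2 (by positivity)
    (sum_nonneg fun ω _ => mul_nonneg (hW ω) (Real.exp_pos _).le)).trans (key.trans h3)
  have h5 : Real.exp (l * a) * (binomialRandom V p).real {G | a ≤ f G} *
      (Real.exp (-(l * (a - t))) * (binomialRandom V p).real {G | f G ≤ a - t}) =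
      Real.exp (l * t) * ((binomialRandom V p).real {G | a ≤ f G} *
        (binomialRandom V p).real {G | f G ≤ a - t}) := by
    have : Real.exp (l * t) = Real.exp (l * a) * Real.exp (-(l * (a - t))) := by
      rw [← Real.exp_add]; congr 1; ring
    rw [this]; ring
  rw [h5, ← le_div_iff₀' (Real.exp_pos _), ← Real.exp_sub] at h4
  refine h4.trans (Real.exp_le_exp.2 (le_of_eq ?_))
  rw [hl]
  field_simp
  ring

/-! ### Weighted counting of partial maps that respect the links of a chain -/

section Chain

variable {T : Type*} (F : SimpleGraph T)

open Classical in
/-- The weight of the value `b` of a partial map into `F` after the linked value `a`. -/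
noncomputable def stepWeight (z y : ℝ) : Option T → Option T → ℝ
  | _, none => 1
  | none, some _ => z
  -- In an overlap, a link sent to a non-edge makes the two copies incompatible, hence weight 0; a
  -- link sent to an edge is shared, and `y` will be 1/p.
  | some s', some s => if F.Adj s' s then y else 0

lemma stepWeight_nonneg {z y : ℝ} (hz : 0 ≤ z) (hy : 0 ≤ y) (a b : Option T) :
    0 ≤ stepWeight F z y a b := by
  rcases a with _ | a <;> rcases b with _ | b <;> simp only [stepWeight] <;>
    first | exact zero_le_one | exact hz | skip
  split_ifs <;> simp [hy]

/-- Marking every defined value by `z` is absorbed into the step weights, so the generating function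
by domain size is again a sum of chain weights. -/
lemma stepWeight_mul (z y : ℝ) (a b : Option T) :
    stepWeight F z (z * y) a b = (if b.isSome then z else 1) * stepWeight F 1 y a b := by
  rcases a with _ | a <;> rcases b with _ | b <;> simp [stepWeight]

open Classical in
/-- The value of `θ` at the predecessor of `t`, provided that `t` is linked to it. -/
noncomputable def chainPrev {n : ℕ} (P : Fin n → Prop) (a : Option T) (θ : Fin n → Option T)
    (t : Fin n) : Option T :=
  if P t then (Fin.cons a θ : Fin (n + 1) → Option T) t.castSucc else none

/-- The product of the weights of all steps of `θ`. -/
noncomputable def chainWeight (z y : ℝ) {n : ℕ} (P : Fin n → Prop) (a : Option T)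
    (θ : Fin n → Option T) : ℝ :=
  ∏ t, stepWeight F z y (chainPrev P a θ t) (θ t)

lemma chainWeight_nonneg {z y : ℝ} (hz : 0 ≤ z) (hy : 0 ≤ y) {n : ℕ} (P : Fin n → Prop)
    (a : Option T) (θ : Fin n → Option T) : 0 ≤ chainWeight F z y P a θ :=
  prod_nonneg fun _ _ => stepWeight_nonneg F hz hy _ _

lemma chainWeight_mul (z y : ℝ) {n : ℕ} (P : Fin n → Prop) (a : Option T)
    (θ : Fin n → Option T) :
    chainWeight F z (z * y) P a θ =
      z ^ (univ.filter fun t => (θ t).isSome).card * chainWeight F 1 y P a θ := by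
  simp only [chainWeight, stepWeight_mul, prod_mul_distrib]
  rw [prod_ite, prod_const, prod_const_one, mul_one]

lemma chainWeight_cons (z y : ℝ) {n : ℕ} (P : Fin (n + 1) → Prop) (a b : Option T)
    (θ : Fin n → Option T) :
    chainWeight F z y P a (Fin.cons b θ : Fin (n + 1) → Option T) =
      stepWeight F z y (chainPrev (fun _ : Fin 1 => P 0) a (fun _ => b) 0) b *
        chainWeight F z y (fun t => P t.succ) b θ := by
  rw [chainWeight, Fin.prod_univ_succ]
  simp [chainWeight, chainPrev]

open Classical in
-- One step of the transfer matrix against the potential 1 at `none` and 2 at `some`. From `some s`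
-- at most two neighbours continue, giving 1 + 2 · 2y ≤ 2; from `none` all values are allowed,
-- giving 1 + 2|T|z.
lemma sum_stepWeight_le [Fintype T] (hF : ∀ s, (univ.filter fun t => F.Adj s t).card ≤ 2)
    {z y : ℝ} (hz : 0 ≤ z) (hy4 : 4 * y ≤ 1) (Q : Prop) (a : Option T) :
    ∑ b, stepWeight F z y (if Q then a else none) b * (if b = none then 1 else 2) ≤
      (1 + 2 * Fintype.card T * z) * (if a = none then 1 else 2) := by
  have hN : 0 ≤ 2 * (Fintype.card T : ℝ) * z := by positivity
  have hpot : (1 : ℝ) ≤ if a = none then 1 else 2 := by split_ifs <;> norm_num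
  have hnone : ∑ b, stepWeight F z y none b * (if b = none then 1 else 2) =
      1 + 2 * Fintype.card T * z := by
    rw [Fintype.sum_option]
    simp [stepWeight, Finset.card_univ]
    ring
  by_cases hQ : Q
  · rw [if_pos hQ]
    rcases a with _ | s
    · rw [hnone]; simp
    · rw [Fintype.sum_option]
      simp only [stepWeight, if_true, mul_one, reduceCtorEq, if_false, ite_mul, zero_mul]
      rw [← sum_filter, sum_const, nsmul_eq_mul]
      have h2 : ((univ.filter fun t => F.Adj s t).card : ℝ) ≤ 2 := by exact_mod_cast hF s
      nlinarith
  · rw [if_neg hQ, hnone]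
    nlinarith

open Classical in
lemma sum_chainWeight_le [Fintype T] (hF : ∀ s, (univ.filter fun t => F.Adj s t).card ≤ 2)
    {z y : ℝ} (hz : 0 ≤ z) (hy : 0 ≤ y) (hy4 : 4 * y ≤ 1) {n : ℕ} :
    ∀ (P : Fin n → Prop) (a : Option T), ∑ θ, chainWeight F z y P a θ ≤
      (1 + 2 * Fintype.card T * z) ^ n * (if a = none then 1 else 2) := by
  induction n with
  | zero =>
    intro P a
    simp only [chainWeight, univ_eq_empty, prod_empty, pow_zero, one_mul]
    simp only [univ_unique, sum_const, card_singleton, one_smul]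
    split_ifs <;> norm_num
  | succ n ih =>
    intro P a
    rw [← (Fin.consEquiv fun _ => Option T).sum_comp, Fintype.sum_prod_type]
    have hC : 0 ≤ (1 + 2 * (Fintype.card T : ℝ) * z) ^ n := by positivity
    calc _ = ∑ b, stepWeight F z y (if P 0 then a else none) b *
          ∑ θ, chainWeight F z y (fun t => P t.succ) b θ := by
          refine sum_congr rfl fun b _ => ?_
          rw [mul_sum]
          refine sum_congr rfl fun θ _ => ?_
          exact chainWeight_cons F z y P a b θ
      _ ≤ ∑ b, stepWeight F z y (if P 0 then a else none) b *
          ((1 + 2 * Fintype.card T * z) ^ n * (if b = none then 1 else 2)) :=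
          sum_le_sum fun b _ => mul_le_mul_of_nonneg_left (ih _ b)
            (stepWeight_nonneg F hz hy _ _)
      _ = (1 + 2 * Fintype.card T * z) ^ n *
          ∑ b, stepWeight F z y (if P 0 then a else none) b * (if b = none then 1 else 2) := by
          rw [mul_sum]
          exact sum_congr rfl fun b _ => by ring
      _ ≤ (1 + 2 * Fintype.card T * z) ^ n *
          ((1 + 2 * Fintype.card T * z) * (if a = none then 1 else 2)) :=
          mul_le_mul_of_nonneg_left (sum_stepWeight_le F hF hz hy4 _ a) hC
      _ = _ := by ring

/-- The generating function of the partial maps by the sizes of their domains. -/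
lemma sum_pow_mul_chainWeight_le [Fintype T] [DecidableEq T] [DecidableRel F.Adj]
    (hF : ∀ s, (univ.filter fun t => F.Adj s t).card ≤ 2)
    {z y : ℝ} (hz : 0 ≤ z) (hy : 0 ≤ y) (hzy : 4 * (z * y) ≤ 1) {n : ℕ} (P : Fin n → Prop) :
    ∑ θ : Fin n → Option T, z ^ (univ.filter fun t => (θ t).isSome).card *
      chainWeight F 1 y P none θ ≤ Real.exp (2 * Fintype.card T * n * z) := by
  simp_rw [← chainWeight_mul]
  have h := sum_chainWeight_le F (by convert hF) hz (mul_nonneg hz hy) hzy P none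
  rw [if_pos rfl, mul_one] at h
  have h2 : (1 + 2 * (Fintype.card T : ℝ) * z) ^ n ≤ Real.exp (2 * Fintype.card T * n * z) := by
    rw [show 2 * (Fintype.card T : ℝ) * n * z = n * (2 * Fintype.card T * z) by ring,
      Real.exp_nat_mul]
    refine pow_le_pow_left₀ (by positivity) ?_ n
    linarith [Real.add_one_le_exp (2 * (Fintype.card T : ℝ) * z)]
  refine le_trans (le_of_eq ?_) (h.trans h2)
  exact sum_congr (by ext; simp) fun _ _ => rfl

lemma chainPrev_of_succ {n : ℕ} {P : Fin n → Prop} (a : Option T) (θ : Fin n → Option T)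
    {s t : Fin n} (hst : s.val + 1 = t.val) (ht : P t) : chainPrev P a θ t = θ s := by
  rw [chainPrev, if_pos ht, show t.castSucc = s.succ from Fin.ext (by simp [hst]), Fin.cons_succ]

lemma exists_of_chainPrev_eq_some {n : ℕ} {P : Fin n → Prop} {θ : Fin n → Option T} {t : Fin n}
    {x : T} (h : chainPrev P none θ t = some x) :
    P t ∧ ∃ s : Fin n, s.val + 1 = t.val ∧ θ s = some x := by
  by_cases ht : P t
  · refine ⟨ht, ?_⟩
    rcases Nat.eq_zero_or_pos t.val with h0 | h0
    · rw [chainPrev, if_pos ht, show t.castSucc = 0 from Fin.ext (by simp [h0]),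
        Fin.cons_zero] at h
      cases h
    · have hs : (⟨t.val - 1, by omega⟩ : Fin n).val + 1 = t.val := by simp; omega
      exact ⟨_, hs, by rw [← h, chainPrev_of_succ none θ hs ht]⟩
  · rw [chainPrev, if_neg ht] at h
    cases h

lemma chainWeight_eq_zero {y : ℝ} {n : ℕ} {P : Fin n → Prop} {θ : Fin n → Option T} {t : Fin n}
    {s' s : T} (h' : chainPrev P none θ t = some s') (h : θ t = some s) (hst : ¬ F.Adj s' s) :
    chainWeight F 1 y P none θ = 0 :=
  prod_eq_zero (mem_univ t) (by simp [h', h, stepWeight, hst])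

lemma chainWeight_eq_pow {y : ℝ} {n : ℕ} {P : Fin n → Prop} {θ : Fin n → Option T}
    (hadj : ∀ t s' s, chainPrev P none θ t = some s' → θ t = some s → F.Adj s' s) :
    chainWeight F 1 y P none θ =
      y ^ (univ.filter fun t => (chainPrev P none θ t).isSome ∧ (θ t).isSome).card := by
  rw [chainWeight, ← prod_const, prod_filter]
  refine prod_congr rfl fun t _ => ?_
  rcases h' : chainPrev P none θ t with _ | s' <;> rcases h : θ t with _ | s <;>
    simp [stepWeight]
  exact fun hn => absurd (hadj t s' s h' h) hn

end Chain

set_option linter.unusedSectionVars false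

/-! ### Induced copies of a fixed graph and their overlaps -/

namespace SimpleGraph

variable {V : Type*} {T : Type*}

/-- The graphs in which `φ` is an induced copy of `F`. -/
def copyEvent (F : SimpleGraph T) (φ : T → V) : Set (SimpleGraph V) :=
  {G | ∀ s t, F.Adj s t ↔ G.Adj (φ s) (φ t)}

variable [Fintype T] [DecidableEq T] [DecidableEq V]

/-- The images under `φ` of the edges of `F`. -/
def imageEdges (F : SimpleGraph T) [DecidableRel F.Adj] (φ : T → V) : Finset (Sym2 V) :=
  F.edgeFinset.image (Sym2.map φ)

lemma mem_imageEdges (F : SimpleGraph T) [DecidableRel F.Adj] (φ : T → V) (e : Sym2 V) :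
    e ∈ imageEdges F φ ↔ ∃ s t, F.Adj s t ∧ s(φ s, φ t) = e := by
  simp only [imageEdges, mem_image, mem_edgeFinset]
  constructor
  · rintro ⟨e', h, rfl⟩
    induction e' using Sym2.ind with
    | _ s t => exact ⟨s, t, h, rfl⟩
  · rintro ⟨s, t, h, rfl⟩
    exact ⟨s(s, t), h, rfl⟩

variable {F : SimpleGraph T} [DecidableRel F.Adj] {φ ψ : T → V}

lemma card_imageEdges (hφ : φ.Injective) : (imageEdges F φ).card = F.edgeFinset.card :=
  card_image_of_injective _ (Sym2.map.injective hφ)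

lemma not_isDiag_of_mem_imageEdges (hφ : φ.Injective) {e : Sym2 V} (he : e ∈ imageEdges F φ) :
    ¬ e.IsDiag := by
  rw [mem_imageEdges] at he
  obtain ⟨s, t, h, rfl⟩ := he
  exact fun hd => h.ne (hφ hd)

lemma mem_copyEvent_iff (G : SimpleGraph V) :
    G ∈ copyEvent F φ ↔
      (∀ e ∈ imageEdges F φ, e ∈ G.edgeSet) ∧ ∀ e ∈ imageEdges Fᶜ φ, e ∉ G.edgeSet := by
  simp only [mem_imageEdges, copyEvent, Set.mem_ofPred_eq]
  constructor
  · intro h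
    refine ⟨?_, ?_⟩
    · rintro _ ⟨s, t, hst, rfl⟩
      exact (h s t).1 hst
    · rintro _ ⟨s, t, hst, rfl⟩ hG
      exact ((compl_adj F s t).1 hst).2 ((h s t).2 hG)
  · rintro ⟨h1, h2⟩ s t
    refine ⟨fun h => h1 _ ⟨s, t, h, rfl⟩, fun h => ?_⟩
    by_contra hF
    exact h2 _ ⟨s, t, (compl_adj F s t).2 ⟨fun hst => h.ne (by rw [hst]), hF⟩, rfl⟩ h

lemma disjoint_imageEdges_of_mem {G : SimpleGraph V}
    (h1 : G ∈ copyEvent F φ) (h2 : G ∈ copyEvent F ψ) :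
    Disjoint (imageEdges F φ) (imageEdges Fᶜ ψ) :=
  Finset.disjoint_left.2 fun e he he' =>
    ((mem_copyEvent_iff G).1 h2).2 e he' (((mem_copyEvent_iff G).1 h1).1 e he)

variable [Fintype V]

lemma disjoint_imageEdges (hφ : φ.Injective) :
    Disjoint (imageEdges F φ) (imageEdges Fᶜ φ) := by
  rw [Finset.disjoint_left]
  intro e he he'
  rw [imageEdges, mem_image] at he he'
  obtain ⟨a, ha, rfl⟩ := he
  obtain ⟨b, hb, hab⟩ := he'
  rw [Sym2.map.injective hφ hab] at hb
  rw [mem_edgeFinset] at ha hb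
  induction a using Sym2.ind with
  | _ s t => exact ((compl_adj F s t).1 hb).2 ha

variable (F) in
/-- The probability that a given injection is an induced copy of `F`. -/
noncomputable def copyProb (p : ℝ) : ℝ := p ^ F.edgeFinset.card * (1 - p) ^ Fᶜ.edgeFinset.card

lemma binomialRandom_real_copyEvent (p : unitInterval) (hφ : φ.Injective) :
    (binomialRandom V p).real (copyEvent F φ) = copyProb F p := by
  have h := binomialRandom_real_cylinder p (imageEdges F φ) (imageEdges Fᶜ φ)
    (fun _ => not_isDiag_of_mem_imageEdges hφ) (fun _ => not_isDiag_of_mem_imageEdges hφ)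
    (disjoint_imageEdges hφ)
  rw [card_imageEdges hφ, card_imageEdges hφ] at h
  rw [copyProb, ← h]
  congr 1
  ext G
  exact mem_copyEvent_iff G

/-- Either the two events are incompatible, or the intersection is a cylinder in which each shared
pair is paid for once instead of twice. Overestimating the numbers of shared pairs is harmless,
since 1/p and 1/(1-p) are at least 1. -/
lemma binomialRandom_real_copyEvent_inter (p : unitInterval) (hp0 : 0 < (p : ℝ))
    (hp1 : (p : ℝ) < 1) (hφ : φ.Injective) (hψ : ψ.Injective) {a b : ℕ}
    (ha : (imageEdges F φ ∩ imageEdges F ψ).card ≤ a)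
    (hb : (imageEdges Fᶜ φ ∩ imageEdges Fᶜ ψ).card ≤ b) :
    (binomialRandom V p).real (copyEvent F φ ∩ copyEvent F ψ) ≤
      copyProb F p ^ 2 * ((p : ℝ)⁻¹ ^ a * (1 - (p : ℝ))⁻¹ ^ b) := by
  have hq : 0 < 1 - (p : ℝ) := by linarith
  rcases (copyEvent F φ ∩ copyEvent F ψ).eq_empty_or_nonempty with h | ⟨G, hG1, hG2⟩
  · rw [h, measureReal_empty]
    have := hp0.le
    have := hq.le
    unfold copyProb
    positivity
  have hd : Disjoint (imageEdges F φ ∪ imageEdges F ψ) (imageEdges Fᶜ φ ∪ imageEdges Fᶜ ψ) := by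
    simp only [Finset.disjoint_union_left, Finset.disjoint_union_right]
    exact ⟨⟨disjoint_imageEdges hφ, disjoint_imageEdges_of_mem hG2 hG1⟩,
      disjoint_imageEdges_of_mem hG1 hG2, disjoint_imageEdges hψ⟩
  have h := binomialRandom_real_cylinder p (imageEdges F φ ∪ imageEdges F ψ)
    (imageEdges Fᶜ φ ∪ imageEdges Fᶜ ψ)
    (fun e he => (mem_union.1 he).elim (not_isDiag_of_mem_imageEdges hφ)
      (not_isDiag_of_mem_imageEdges hψ))
    (fun e he => (mem_union.1 he).elim (not_isDiag_of_mem_imageEdges hφ)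
      (not_isDiag_of_mem_imageEdges hψ)) hd
  have hset : copyEvent F φ ∩ copyEvent F ψ =
      {G | (∀ e ∈ imageEdges F φ ∪ imageEdges F ψ, e ∈ G.edgeSet) ∧
        ∀ e ∈ imageEdges Fᶜ φ ∪ imageEdges Fᶜ ψ, e ∉ G.edgeSet} := by
    ext G
    rw [Set.mem_inter_iff, mem_copyEvent_iff, mem_copyEvent_iff]
    simp only [mem_union, Set.mem_ofPred_eq, or_imp, forall_and]
    tauto
  rw [hset, h]
  have hpow : ∀ (x : ℝ), 0 < x → x ≤ 1 → ∀ (H : SimpleGraph T) [DecidableRel H.Adj] (c : ℕ),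
      (imageEdges H φ ∩ imageEdges H ψ).card ≤ c →
      x ^ (imageEdges H φ ∪ imageEdges H ψ).card ≤ (x ^ H.edgeFinset.card) ^ 2 * x⁻¹ ^ c := by
    intro x hx hx1 H _ c hc
    have hcard := card_union_add_card_inter (imageEdges H φ) (imageEdges H ψ)
    rw [card_imageEdges hφ, card_imageEdges hψ] at hcard
    rw [inv_pow, ← div_eq_mul_inv, le_div_iff₀ (pow_pos hx c), ← pow_add, ← pow_mul]
    exact pow_le_pow_of_le_one hx.le hx1 (by omega)
  calc _ ≤ (((p : ℝ) ^ F.edgeFinset.card) ^ 2 * (p : ℝ)⁻¹ ^ a) *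
        (((1 - (p : ℝ)) ^ Fᶜ.edgeFinset.card) ^ 2 * (1 - (p : ℝ))⁻¹ ^ b) :=
        mul_le_mul (hpow p hp0 hp1.le F a ha) (hpow _ hq (by linarith) Fᶜ b hb)
          (by positivity) (by positivity)
    _ = _ := by rw [copyProb]; ring

/-! ### The overlap of two copies as a partial map -/

open Classical in
/-- The partial map `φ⁻¹ ∘ ψ`. -/
noncomputable def overlap (φ ψ : T → V) (t : T) : Option T :=
  if h : ∃ s, φ s = ψ t then some h.choose else none

lemma apply_of_overlap_eq_some {t s : T} (h : overlap φ ψ t = some s) : φ s = ψ t := by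
  unfold overlap at h
  split_ifs at h with h'
  rw [← Option.some_inj.1 h]
  exact h'.choose_spec

lemma overlap_isSome {t s : T} (h : φ s = ψ t) : (overlap φ ψ t).isSome := by
  rw [overlap, dif_pos ⟨s, h⟩]
  rfl

/-- Both ends of a common pair come from the domain of the overlap. Applied to `Fᶜ`, this crude
count of shared non-edges suffices, since each costs only 1/(1-p). -/
lemma card_imageEdges_inter_le :
    (imageEdges F φ ∩ imageEdges F ψ).card ≤
      (univ.filter fun t => (overlap φ ψ t).isSome).card.choose 2 := by
  rw [← Sym2.card_image_offDiag]
  refine (card_le_card ?_).trans (card_image_le (f := Sym2.map ψ))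
  intro e he
  rw [mem_inter, mem_imageEdges, mem_imageEdges] at he
  obtain ⟨⟨a, b, -, hab⟩, s, t, hst, rfl⟩ := he
  rw [mem_image]
  refine ⟨s(s, t), mem_image.2 ⟨(s, t), ?_, rfl⟩, rfl⟩
  rw [mem_offDiag]
  simp only [mem_filter, mem_univ, true_and]
  rw [Sym2.eq_iff] at hab
  rcases hab with ⟨h1, h2⟩ | ⟨h1, h2⟩
  · exact ⟨overlap_isSome h1, overlap_isSome h2, hst.ne⟩
  · exact ⟨overlap_isSome h2, overlap_isSome h1, hst.ne⟩

lemma binomialRandom_real_copyEvent_inter_le_chainWeight {n : ℕ} {F : SimpleGraph (Fin n)}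
    [DecidableRel F.Adj] {P : Fin n → Prop}
    (hF : ∀ s t, F.Adj s t ↔ (s.val + 1 = t.val ∧ P t) ∨ (t.val + 1 = s.val ∧ P s))
    {φ ψ : Fin n → V} (p : unitInterval) (hp0 : 0 < (p : ℝ))
    (hp1 : (p : ℝ) < 1) (hφ : φ.Injective) (hψ : ψ.Injective) :
    (binomialRandom V p).real (copyEvent F φ ∩ copyEvent F ψ) ≤
      copyProb F p ^ 2 * (chainWeight F 1 (p : ℝ)⁻¹ P none (overlap φ ψ) *
        (1 - (p : ℝ))⁻¹ ^ (univ.filter fun t => (overlap φ ψ t).isSome).card.choose 2) := by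
  have hq : 0 < 1 - (p : ℝ) := by linarith
  by_cases hadj : ∀ t s' s, chainPrev P none (overlap φ ψ) t = some s' →
      overlap φ ψ t = some s → F.Adj s' s
  · rw [chainWeight_eq_pow F hadj]
    refine binomialRandom_real_copyEvent_inter p hp0 hp1 hφ hψ ?_ card_imageEdges_inter_le
    -- Each shared edge is indexed by its later end `t`. The truncated predecessor of 0 is a dummy:
    -- no link ends at 0.
    have hne : ∀ t : Fin n, t.val - 1 < n := fun t => by omega
    refine (card_le_card ?_).trans
      (card_image_le (f := fun t : Fin n => s(ψ ⟨t.val - 1, hne t⟩, ψ t)))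
    intro e he
    rw [mem_inter, mem_imageEdges, mem_imageEdges] at he
    obtain ⟨⟨a, b, -, hab⟩, s, t, hst, rfl⟩ := he
    wlog h : s.val + 1 = t.val ∧ P t generalizing s t
    · rw [Sym2.eq_swap]
      refine this t s hst.symm (by rw [hab, Sym2.eq_swap]) ?_
      exact ((hF s t).1 hst).resolve_left h
    have hs : (⟨t.val - 1, hne t⟩ : Fin n) = s := Fin.ext (by simp; omega)
    rw [mem_image]
    refine ⟨t, ?_, by rw [hs]⟩
    rw [mem_filter, chainPrev_of_succ none _ h.1 h.2]
    rw [Sym2.eq_iff] at hab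
    rcases hab with ⟨h1, h2⟩ | ⟨h1, h2⟩
    · exact ⟨mem_univ _, overlap_isSome h1, overlap_isSome h2⟩
    · exact ⟨mem_univ _, overlap_isSome h2, overlap_isSome h1⟩
  · push Not at hadj
    obtain ⟨t, s', s, h', h, hst⟩ := hadj
    rw [chainWeight_eq_zero F h' h hst, zero_mul, mul_zero]
    refine le_of_eq ?_
    have : copyEvent F φ ∩ copyEvent F ψ = ∅ := by
      rw [Set.eq_empty_iff_forall_notMem]
      rintro G ⟨hG1, hG2⟩
      obtain ⟨hPt, t', ht', h''⟩ := exists_of_chainPrev_eq_some h'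
      refine hst ((hG1 s' s).2 ?_)
      rw [apply_of_overlap_eq_some h'', apply_of_overlap_eq_some h]
      exact (hG2 t' t).1 ((hF t' t).2 (Or.inl ⟨ht', hPt⟩))
    rw [this, measureReal_empty]

end SimpleGraph

/-! ### Counting transversal maps with a prescribed part -/

section Transversal

variable {V ι T : Type*} [Fintype V] [DecidableEq V] [DecidableEq ι] [Fintype T] [DecidableEq T]

open Classical in
/-- The maps into `V` that meet each block at most once. -/
noncomputable def transversals (T : Type*) [Fintype T] (b : V → ι) : Finset (T → V) :=
  univ.filter fun ψ => Function.Injective (b ∘ ψ)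

lemma mem_transversals {b : V → ι} {ψ : T → V} :
    ψ ∈ transversals T b ↔ Function.Injective (b ∘ ψ) := by
  simp [transversals]

/-- The transversal maps that agree with `τ` on `I`. -/
noncomputable def transversalsAgreeing (b : V → ι) (τ : T → V) (I : Finset T) : Finset (T → V) :=
  (transversals T b).filter fun ψ => ∀ t ∈ I, ψ t = τ t

lemma mem_transversalsAgreeing {b : V → ι} {τ : T → V} {I : Finset T} {ψ : T → V} :
    ψ ∈ transversalsAgreeing b τ I ↔ ψ ∈ transversals T b ∧ ∀ t ∈ I, ψ t = τ t :=
  mem_filter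

open Classical in
-- Prescribed values are released one at a time: a released value may be any of at least `D`
-- vertices outside the blocks of the other values. Only this ratio of counts is needed, never the
-- number of transversals itself.
lemma card_transversalsAgreeing_mul_le (b : V → ι) {D : ℕ}
    (hD : ∀ S : Finset ι, S.card ≤ Fintype.card T → D ≤ (univ.filter fun v => b v ∉ S).card)
    (τ : T → V) (I : Finset T) :
    (transversalsAgreeing b τ I).card * D ^ I.card ≤
      (transversals T b).card := by
  induction I using Finset.induction_on with
  | empty => simp [transversalsAgreeing]
  | insert t₀ I ht₀ ih =>
    refine le_trans ?_ ih
    rw [card_insert_of_notMem ht₀, pow_succ', ← mul_assoc]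
    refine Nat.mul_le_mul_right _ ?_
    set A := transversalsAgreeing b τ (insert t₀ I)
    let S : (T → V) → Finset ι := fun ψ => (univ.erase t₀).image (b ∘ ψ)
    let X : Finset (Σ _ : T → V, V) := A.sigma fun ψ => univ.filter fun v => b v ∉ S ψ
    have hX : A.card * D ≤ X.card := by
      rw [card_sigma, ← smul_eq_mul]
      refine card_nsmul_le_sum _ _ _ fun ψ _ => hD _ ?_
      exact card_image_le.trans (card_le_univ _)
    refine hX.trans ?_
    -- Injective because the overwritten value is known to be `τ t₀`.
    refine card_le_card_of_injOn (fun x => Function.update x.1 t₀ x.2) ?_ ?_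
    · rintro ⟨ψ, v⟩ hx
      simp only [X, A, S, coe_sigma, Set.mem_sigma_iff, mem_coe, mem_filter, mem_univ, true_and,
        mem_transversalsAgreeing, mem_transversals, mem_image, mem_erase, not_exists, not_and, and_true] at hx ⊢
      obtain ⟨⟨hψ, hτ⟩, hv⟩ := hx
      refine ⟨?_, fun t ht => ?_⟩
      · intro s t hst
        simp only [Function.comp_apply] at hst hv
        by_cases hs : s = t₀ <;> by_cases ht : t = t₀
        · rw [hs, ht]
        · subst hs
          rw [Function.update_self, Function.update_of_ne ht] at hst
          exact (hv t ht hst.symm).elim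
        · subst ht
          rw [Function.update_self, Function.update_of_ne hs] at hst
          exact (hv s hs hst).elim
        · rw [Function.update_of_ne hs, Function.update_of_ne ht] at hst
          exact hψ hst
      · have : t ≠ t₀ := fun h => ht₀ (h ▸ ht)
        rw [Function.update_of_ne this]
        exact hτ t (mem_insert_of_mem ht)
    · rintro ⟨ψ, v⟩ hx ⟨ψ', v'⟩ hx' h
      simp only [X, A, coe_sigma, Set.mem_sigma_iff, mem_coe, mem_filter,
        mem_transversalsAgreeing] at hx hx'
      have hv : v = v' := by simpa using congrFun h t₀
      have hψ : ψ = ψ' := by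
        funext t
        by_cases ht : t = t₀
        · rw [ht, hx.1.2 _ (mem_insert_self _ _), hx'.1.2 _ (mem_insert_self _ _)]
        · have := congrFun h t
          simpa [Function.update_of_ne ht] using this
      rw [hv, hψ]

end Transversal

/-! ### The second moment -/

namespace SimpleGraph

variable {V : Type*} [Fintype V] [DecidableEq V]

open Classical in
-- Cauchy–Schwarz applied to X = X · 1[X > 0], where X counts the events that occur.
lemma sq_sum_prob_le {α : Type*} (p : unitInterval) (s : Finset α)
    (A : α → Set (SimpleGraph V)) :
    (∑ a ∈ s, (binomialRandom V p).real (A a)) ^ 2 ≤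
      (binomialRandom V p).real {G | ∃ a ∈ s, G ∈ A a} *
        ∑ a ∈ s, ∑ a' ∈ s, (binomialRandom V p).real (A a ∩ A a') := by
  set W : (Edge V → Bool) → ℝ := fun ω => ∏ e, bernoulliWeight p (ω e) with hWdef
  have hW : ∀ ω, 0 ≤ W ω := fun ω => prod_nonneg fun e _ => bernoulliWeight_nonneg p.2.1 p.2.2 _
  set X : (Edge V → Bool) → ℝ := fun ω => ∑ a ∈ s, (A a).indicator 1 (graphOf ω) with hXdef
  have h1 : ∑ a ∈ s, (binomialRandom V p).real (A a) = ∑ ω, W ω * X ω := by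
    simp_rw [binomialRandom_real_eq_sum]
    rw [sum_comm]
    exact sum_congr rfl fun ω _ => by rw [hXdef, mul_sum]
  have h2 : ∑ a ∈ s, ∑ a' ∈ s, (binomialRandom V p).real (A a ∩ A a') = ∑ ω, W ω * X ω ^ 2 := by
    have : ∀ ω, W ω * X ω ^ 2 = ∑ a ∈ s, ∑ a' ∈ s, W ω * (A a ∩ A a').indicator 1 (graphOf ω) := by
      intro ω
      rw [hXdef, sq, sum_mul_sum, mul_sum]
      refine sum_congr rfl fun a _ => ?_
      rw [mul_sum]
      refine sum_congr rfl fun a' _ => ?_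
      rw [Set.inter_indicator_one, Pi.mul_apply]
    simp_rw [this, binomialRandom_real_eq_sum]
    rw [sum_comm (s := univ) (t := s)]
    exact sum_congr rfl fun a _ => sum_comm
  rw [h1, h2, binomialRandom_real_eq_sum]
  refine sum_sq_le_sum_mul_sum_of_sq_le_mul _
    (fun ω _ => mul_nonneg (hW ω) (Set.indicator_nonneg (fun _ _ => zero_le_one) _))
    (fun ω _ => mul_nonneg (hW ω) (sq_nonneg _)) fun ω _ => le_of_eq ?_
  by_cases h : ∃ a ∈ s, graphOf ω ∈ A a
  · simp only [Set.indicator_apply, Set.mem_ofPred_eq, h, if_true, Pi.one_apply]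
    ring
  · have hX : X ω = 0 := by
      refine sum_eq_zero fun a ha => ?_
      rw [Set.indicator_of_notMem]
      exact fun hh => h ⟨a, ha, hh⟩
    rw [hX]
    ring

variable {ι : Type*} [DecidableEq ι]

open Classical in
-- For fixed `φ`, an overlap `θ` prescribes `ψ` on the domain of `θ`, which leaves at most a
-- fraction D^(-|dom θ|) of the transversals.
lemma sum_overlap_le {n : ℕ} {b : V → ι} {D : ℕ} (hD0 : 0 < D)
    (hD : ∀ S : Finset ι, S.card ≤ n → D ≤ (univ.filter fun v => b v ∉ S).card)
    (φ : Fin n → V) (H : (Fin n → Option (Fin n)) → ℝ) (hH : ∀ θ, 0 ≤ H θ) :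
    ∑ ψ ∈ transversals (Fin n) b, H (overlap φ ψ) ≤
      (transversals (Fin n) b).card *
        ∑ θ, (D : ℝ)⁻¹ ^ (univ.filter fun t => (θ t).isSome).card * H θ := by
  rw [← sum_fiberwise _ (fun ψ => overlap φ ψ), mul_sum]
  refine sum_le_sum fun θ _ => ?_
  have h1 : ∑ ψ ∈ (transversals (Fin n) b).filter (fun ψ => overlap φ ψ = θ), H (overlap φ ψ) =
      ((transversals (Fin n) b).filter (fun ψ => overlap φ ψ = θ)).card * H θ := by
    rw [← nsmul_eq_mul, ← sum_const]
    exact sum_congr rfl fun ψ hψ => by rw [(mem_filter.1 hψ).2]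
  rw [h1, ← mul_assoc]
  refine mul_le_mul_of_nonneg_right ?_ (hH θ)
  have hD' : (0 : ℝ) < D := by exact_mod_cast hD0
  rw [inv_pow, ← div_eq_mul_inv, le_div_iff₀ (pow_pos hD' _)]
  have h2 := card_transversalsAgreeing_mul_le (T := Fin n) b (by simpa using hD)
    -- The default value is never used: agreement is required only where `θ` is defined.
    (fun t => φ ((θ t).getD t)) (univ.filter fun t => (θ t).isSome)
  norm_cast
  refine (Nat.mul_le_mul_right _ (card_le_card fun ψ hψ => ?_)).trans h2
  rw [mem_filter] at hψ
  refine mem_transversalsAgreeing.2 ⟨hψ.1, fun t ht => ?_⟩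
  rw [mem_filter] at ht
  obtain ⟨s, hs⟩ := Option.isSome_iff_exists.1 ht.2
  rw [hs, Option.getD_some]
  rw [← hψ.2] at hs
  exact (apply_of_overlap_eq_some hs).symm

/-- A lower bound for the probability that the random graph has a transversal induced copy of a
graph `F` whose edges join consecutive elements of `Fin n`. -/
theorem one_le_mul_prob_exists_copy {n : ℕ} {F : SimpleGraph (Fin n)}
    [DecidableRel F.Adj] {P : Fin n → Prop}
    (hF : ∀ s t, F.Adj s t ↔ (s.val + 1 = t.val ∧ P t) ∨ (t.val + 1 = s.val ∧ P s))
    (p : unitInterval) (hp0 : 0 < (p : ℝ)) (hp1 : (p : ℝ) < 1)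
    {b : V → ι} {D : ℕ} (hD0 : 0 < D)
    (hD : ∀ S : Finset ι, S.card ≤ n → D ≤ (univ.filter fun v => b v ∉ S).card)
    (hne : (transversals (Fin n) b).Nonempty) {R : ℝ}
    (hR : ∑ θ, (D : ℝ)⁻¹ ^ (univ.filter fun t => (θ t).isSome).card *
      (chainWeight F 1 (p : ℝ)⁻¹ P none θ *
        (1 - (p : ℝ))⁻¹ ^ (univ.filter fun t => (θ t).isSome).card.choose 2) ≤ R) :
    1 ≤ R * (binomialRandom V p).real
      {G | ∃ ψ ∈ transversals (Fin n) b, G ∈ copyEvent F ψ} := by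
  have hq : 0 < 1 - (p : ℝ) := by linarith
  set s := transversals (Fin n) b with hs
  have hinj : ∀ ψ ∈ s, Function.Injective ψ := fun ψ hψ =>
    Function.Injective.of_comp (mem_transversals.1 hψ)
  set H : (Fin n → Option (Fin n)) → ℝ := fun θ => chainWeight F 1 (p : ℝ)⁻¹ P none θ *
        (1 - (p : ℝ))⁻¹ ^ (univ.filter fun t => (θ t).isSome).card.choose 2 with hHdef
  have hH : ∀ θ, 0 ≤ H θ := fun θ =>
    mul_nonneg (chainWeight_nonneg F zero_le_one (by positivity) _ _ _) (by positivity)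
  have key := sq_sum_prob_le p s (copyEvent F)
  rw [sum_congr rfl fun ψ hψ => binomialRandom_real_copyEvent p (hinj ψ hψ), sum_const,
    nsmul_eq_mul] at key
  have hq' : 0 < copyProb F (p : ℝ) := by unfold copyProb; positivity
  have hcard : (0 : ℝ) < s.card := by exact_mod_cast hne.card_pos
  have h2 : ∑ φ ∈ s, ∑ ψ ∈ s, (binomialRandom V p).real (copyEvent F φ ∩ copyEvent F ψ) ≤
      s.card * (copyProb F p ^ 2 * (s.card * R)) := by
    rw [← nsmul_eq_mul, ← sum_const]
    refine sum_le_sum fun φ hφ => ?_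
    calc _ ≤ ∑ ψ ∈ s, copyProb F p ^ 2 * H (overlap φ ψ) :=
          sum_le_sum fun ψ hψ => binomialRandom_real_copyEvent_inter_le_chainWeight hF p hp0 hp1
            (hinj φ hφ) (hinj ψ hψ)
      _ = copyProb F p ^ 2 * ∑ ψ ∈ s, H (overlap φ ψ) := (mul_sum _ _ _).symm
      _ ≤ _ := by
          refine mul_le_mul_of_nonneg_left ?_ (by positivity)
          refine (sum_overlap_le hD0 hD φ H hH).trans ?_
          exact mul_le_mul_of_nonneg_left hR hcard.le
  have h3 := key.trans (mul_le_mul_of_nonneg_left h2 measureReal_nonneg)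
  have h4 : ((s.card : ℝ) * copyProb F p) ^ 2 * 1 ≤ ((s.card : ℝ) * copyProb F p) ^ 2 *
      (R * (binomialRandom V p).real {G | ∃ ψ ∈ s, G ∈ copyEvent F ψ}) := by
    rw [mul_one]
    refine h3.trans (le_of_eq ?_)
    ring
  exact le_of_mul_le_mul_left h4 (by positivity)

end SimpleGraph

/-! ### Bounding the overlap sum -/

namespace SimpleGraph

lemma degree_le_two_of_links {n : ℕ} {F : SimpleGraph (Fin n)} [DecidableRel F.Adj]
    {P : Fin n → Prop}
    (hF : ∀ s t, F.Adj s t ↔ (s.val + 1 = t.val ∧ P t) ∨ (t.val + 1 = s.val ∧ P s)) (s : Fin n) :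
    (univ.filter fun t => F.Adj s t).card ≤ 2 := by
  rw [← card_image_of_injective _ Fin.val_injective]
  refine (card_le_card (t := {s.val + 1, s.val - 1}) fun i hi => ?_).trans card_le_two
  rw [mem_image] at hi
  obtain ⟨t, ht, rfl⟩ := hi
  rw [mem_filter, hF] at ht
  simp only [mem_insert, mem_singleton]
  omega

lemma inv_pow_choose_two_le {p : ℝ} (hp1 : p < 1) {h : ℝ} (hh : 0 ≤ h)
    (hr : (1 - p)⁻¹ ≤ Real.exp h) (i : ℕ) :
    (1 - p)⁻¹ ^ i.choose 2 ≤ Real.exp (h * i / 2) ^ i := by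
  have hq : 0 < 1 - p := by linarith
  calc (1 - p)⁻¹ ^ i.choose 2 ≤ Real.exp h ^ i.choose 2 := pow_le_pow_left₀ (by positivity) hr _
    _ = Real.exp (i.choose 2 * h) := (Real.exp_nat_mul _ _).symm
    _ ≤ Real.exp (i * (h * i / 2)) := by
        rw [Real.exp_le_exp, Nat.cast_choose_two]
        have : (0 : ℝ) ≤ i := by positivity
        nlinarith [mul_nonneg hh this]
    _ = _ := Real.exp_nat_mul _ _

/-- The normalised second moment is at most `exp (2 e n² / D) + 2`. -/
lemma overlap_sum_le {n : ℕ} {F : SimpleGraph (Fin n)} [DecidableRel F.Adj]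
    {P : Fin n → Prop}
    (hF : ∀ s t, F.Adj s t ↔ (s.val + 1 = t.val ∧ P t) ∨ (t.val + 1 = s.val ∧ P s))
    {p h D : ℝ} (hp0 : 0 < p) (hp1 : p < 1) (hh : 0 ≤ h) (hr : (1 - p)⁻¹ ≤ Real.exp h)
    (hD : 0 < D) (hnp : 2 ≤ n * p) (hDp : 4 * Real.exp 1 ≤ D * p)
    (hlarge : ∀ i : ℕ, i ≤ n → 2 < h * i → 4 * Real.exp 1 * n ^ 2 * Real.exp (h * i / 2) ≤ D * i) :
    ∑ θ : Fin n → Option (Fin n), D⁻¹ ^ (univ.filter fun t => (θ t).isSome).card *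
      (chainWeight F 1 p⁻¹ P none θ *
        (1 - p)⁻¹ ^ (univ.filter fun t => (θ t).isSome).card.choose 2) ≤
      Real.exp (2 * Real.exp 1 * n ^ 2 / D) + 2 := by
  set c : (Fin n → Option (Fin n)) → ℕ := fun θ => (univ.filter fun t => (θ t).isSome).card
    with hc
  set W := chainWeight F 1 p⁻¹ P none with hW
  have hW0 : ∀ θ, 0 ≤ W θ := chainWeight_nonneg F zero_le_one (by positivity) P none
  have hq : 0 < 1 - p := by linarith
  have hn : (0 : ℝ) < n := by
    rcases Nat.eq_zero_or_pos n with h0 | h0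
    · rw [h0] at hnp; norm_num at hnp
    · exact_mod_cast h0
  have hgen : ∀ z : ℝ, 0 ≤ z → 4 * z ≤ p → ∑ θ, z ^ c θ * W θ ≤ Real.exp (2 * n ^ 2 * z) := by
    intro z hz hzp
    have := sum_pow_mul_chainWeight_le F (degree_le_two_of_links hF) hz (inv_nonneg.2 hp0.le)
      (by rw [← mul_assoc, ← div_eq_mul_inv, div_le_one hp0]; exact hzp) P
    rw [Fintype.card_fin] at this
    refine this.trans (le_of_eq ?_)
    ring_nf
  have hcn : ∀ θ, c θ ≤ n := fun θ => (card_le_univ _).trans (by simp)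
  have hterm : ∀ θ, D⁻¹ ^ c θ * (W θ * (1 - p)⁻¹ ^ (c θ).choose 2) ≤
      (Real.exp (h * c θ / 2) / D) ^ c θ * W θ := by
    intro θ
    rw [div_pow, div_eq_inv_mul, inv_pow, mul_assoc, mul_comm (W θ)]
    refine mul_le_mul_of_nonneg_left ?_ (by positivity)
    exact mul_le_mul_of_nonneg_right (inv_pow_choose_two_le hp1 hh hr _) (hW0 θ)
  -- For h |dom θ| ≤ 2 the non-edge factor is at most e per vertex, so the generating function at z
  -- = e/D handles all small overlaps at once. Large overlaps are treated size by size.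
  have hsplit : ∀ θ, D⁻¹ ^ c θ * (W θ * (1 - p)⁻¹ ^ (c θ).choose 2) ≤
      (Real.exp 1 / D) ^ c θ * W θ +
        if 2 < h * c θ then (Real.exp (h * c θ / 2) / D) ^ c θ * W θ else 0 := by
    intro θ
    have h0 : 0 ≤ (Real.exp 1 / D) ^ c θ * W θ := mul_nonneg (by positivity) (hW0 θ)
    refine (hterm θ).trans ?_
    split_ifs with hi
    · linarith
    · rw [add_zero]
      refine mul_le_mul_of_nonneg_right (pow_le_pow_left₀ (by positivity) ?_ _) (hW0 θ)
      refine div_le_div_of_nonneg_right (Real.exp_le_exp.2 ?_) hD.le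
      linarith
  refine (sum_le_sum fun θ _ => hsplit θ).trans ?_
  rw [sum_add_distrib]
  refine add_le_add ?_ ?_
  · refine (hgen _ (by positivity) ?_).trans (le_of_eq ?_)
    · rw [mul_div_assoc', div_le_iff₀ hD]
      linarith
    · congr 1; ring
  · rw [← sum_fiberwise_of_maps_to (s := univ) (t := range (n + 1)) (g := c)
      (fun θ _ => mem_range.2 (Nat.lt_succ_of_le (hcn θ)))]
    have hgeom : ∑ i ∈ range (n + 1), (1 / 2 : ℝ) ^ i ≤ 2 := by
      have := geom_sum_eq (show (1 / 2 : ℝ) ≠ 1 by norm_num) (n + 1)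
      rw [this, div_le_iff_of_neg (by norm_num)]
      have : (0 : ℝ) ≤ (1 / 2) ^ (n + 1) := by positivity
      linarith
    refine le_trans (sum_le_sum fun i hi => ?_) hgeom
    have hin : i ≤ n := Nat.lt_succ_iff.1 (mem_range.1 hi)
    by_cases h2 : 2 < h * i
    · have hi0 : (0 : ℝ) < i := by
        rcases Nat.eq_zero_or_pos i with h0 | h0
        · rw [h0] at h2; norm_num at h2
        · exact_mod_cast h0
      -- This z minimises z^(-i) exp(2n²z), the bound for overlaps of size `i`, and turns the
      -- exponential into eⁱ. The condition 4z ≤ p follows from i ≤ n and np ≥ 2.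
      set z : ℝ := i / (2 * n ^ 2) with hz
      have hz0 : 0 < z := by positivity
      have hzp : 4 * z ≤ p := by
        have hin' : (i : ℝ) ≤ n := by exact_mod_cast hin
        rw [hz, mul_div_assoc', div_le_iff₀ (by positivity)]
        nlinarith
      have hfib : ∑ θ ∈ univ.filter (fun θ => c θ = i),
          (if 2 < h * c θ then (Real.exp (h * c θ / 2) / D) ^ c θ * W θ else 0) =
          (Real.exp (h * i / 2) / D / z) ^ i * ∑ θ ∈ univ.filter (fun θ => c θ = i),
            z ^ c θ * W θ := by
        rw [mul_sum]
        refine sum_congr rfl fun θ hθ => ?_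
        rw [(mem_filter.1 hθ).2, if_pos h2, div_pow _ z, ← mul_assoc,
          div_mul_cancel₀ _ (pow_pos hz0 i).ne']
      rw [hfib]
      have hle : ∑ θ ∈ univ.filter (fun θ => c θ = i), z ^ c θ * W θ ≤ Real.exp 1 ^ i := by
        refine le_trans (sum_le_sum_of_subset_of_nonneg (filter_subset _ _) fun θ _ _ =>
          mul_nonneg (by positivity) (hW0 θ)) ((hgen z hz0.le hzp).trans (le_of_eq ?_))
        rw [← Real.exp_nat_mul]
        congr 1
        rw [hz]
        field_simp
      calc _ ≤ (Real.exp (h * i / 2) / D / z) ^ i * Real.exp 1 ^ i :=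
            mul_le_mul_of_nonneg_left hle (by positivity)
        _ = (Real.exp (h * i / 2) / D / z * Real.exp 1) ^ i := (mul_pow _ _ _).symm
        _ ≤ (1 / 2) ^ i := by
            refine pow_le_pow_left₀ (by positivity) ?_ i
            have := hlarge i hin h2
            rw [hz]
            rw [show Real.exp (h * i / 2) / D / (i / (2 * (n : ℝ) ^ 2)) * Real.exp 1 =
              (2 * Real.exp 1 * n ^ 2 * Real.exp (h * i / 2)) / (D * i) by field_simp,
              div_le_iff₀ (by positivity)]
            linarith
    · refine le_trans (le_of_eq (sum_eq_zero fun θ hθ => ?_)) (by positivity)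
      rw [(mem_filter.1 hθ).2, if_neg h2]

end SimpleGraph

/-! ### Linear forests with components of equal order -/

namespace SimpleGraph

/-- The disjoint union of `k` paths with `L` vertices each. -/
def pathForest (k L : ℕ) : SimpleGraph (Fin k × Fin L) where
  Adj s t := s.1 = t.1 ∧ (pathGraph L).Adj s.2 t.2
  symm := ⟨fun _ _ h => ⟨h.1.symm, h.2.symm⟩⟩
  loopless := ⟨fun _ h => h.2.ne rfl⟩

lemma pathForest_adj {k L : ℕ} (s t : Fin k × Fin L) :
    (pathForest k L).Adj s t ↔ s.1 = t.1 ∧ (pathGraph L).Adj s.2 t.2 := Iff.rfl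

/-- The vertices of `pathForest k L` in consecutive order. -/
def pathForestFin (k L : ℕ) : SimpleGraph (Fin (k * L)) :=
  (pathForest k L).comap finProdFinEquiv.symm

/-- Numbering the paths one after another makes the forest a chain with some links removed, the form
that the overlap estimates require; the missing links are those into multiples of `L`. -/
lemma pathForestFin_adj {k L : ℕ} (s t : Fin (k * L)) :
    (pathForestFin k L).Adj s t ↔
      (s.val + 1 = t.val ∧ t.val % L ≠ 0) ∨ (t.val + 1 = s.val ∧ s.val % L ≠ 0) := by
  obtain ⟨⟨a, x⟩, rfl⟩ := finProdFinEquiv.surjective s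
  obtain ⟨⟨a', x'⟩, rfl⟩ := finProdFinEquiv.surjective t
  rw [pathForestFin, comap_adj, Equiv.symm_apply_apply, Equiv.symm_apply_apply, pathForest_adj,
    pathGraph_adj]
  simp only [finProdFinEquiv_apply_val, Nat.add_mul_mod_self_left, Nat.mod_eq_of_lt x.2,
    Nat.mod_eq_of_lt x'.2, Fin.ext_iff]
  have key : ∀ (a a' x x' : ℕ), x < L → x' < L → x' ≠ 0 → x + L * a + 1 = x' + L * a' →
      a = a' := by
    intro a a' x x' hx hx' h0 h
    rcases lt_trichotomy a a' with hlt | heq | hgt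
    · have := Nat.mul_le_mul_left L hlt
      rw [Nat.mul_succ] at this
      omega
    · exact heq
    · have := Nat.mul_le_mul_left L hgt
      rw [Nat.mul_succ] at this
      omega
  constructor
  · rintro ⟨h, h' | h'⟩
    · left; rw [h]; omega
    · right; rw [h]; omega
  · rintro (⟨h, h'⟩ | ⟨h, h'⟩)
    · have := key a a' x x' x.2 x'.2 h' h
      refine ⟨this, Or.inl ?_⟩
      rw [this] at h
      omega
    · have := key a' a x' x x'.2 x.2 h' h
      refine ⟨this.symm, Or.inr ?_⟩
      rw [this] at h
      omega

variable {V : Type*}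

/-- `G` has an induced copy of `pathForest k L` that meets each block at most once. -/
def HasTransversalForest {ι : Type*} (b : V → ι) (L : ℕ) (G : SimpleGraph V) (k : ℕ) : Prop :=
  ∃ ψ : Fin k × Fin L → V, Function.Injective (b ∘ ψ) ∧ G ∈ copyEvent (pathForest k L) ψ

lemma hasTransversalForest_of_copy {ι : Type*} {b : V → ι} {L : ℕ} {G : SimpleGraph V} {k : ℕ}
    {ψ : Fin (k * L) → V} (hψ : Function.Injective (b ∘ ψ))
    (hG : G ∈ copyEvent (pathForestFin k L) ψ) : HasTransversalForest b L G k := by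
  refine ⟨ψ ∘ finProdFinEquiv, hψ.comp finProdFinEquiv.injective, fun s t => ?_⟩
  rw [Function.comp_apply, Function.comp_apply, ← hG]
  simp [pathForestFin]

lemma hasTransversalForest_zero {ι : Type*} (b : V → ι) (L : ℕ) (G : SimpleGraph V) :
    HasTransversalForest b L G 0 :=
  ⟨fun x => x.1.elim0, fun x => x.1.elim0, fun x => x.1.elim0⟩

/-- Changing the edges at one block destroys at most one component. -/
lemma HasTransversalForest.of_changed_block {ι : Type*} {b : V → ι} {L : ℕ} {G G' : SimpleGraph V}
    {k : ℕ} (j : ι) (hGG' : ∀ u v, b u ≠ j → b v ≠ j → (G.Adj u v ↔ G'.Adj u v))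
    (h : HasTransversalForest b L G (k + 1)) : HasTransversalForest b L G' k := by
  obtain ⟨ψ, hψ, hG⟩ := h
  obtain ⟨c, hc⟩ : ∃ c : Fin (k + 1), ∀ s : Fin (k + 1) × Fin L, b (ψ s) = j → s.1 = c := by
    by_cases h : ∃ s, b (ψ s) = j
    · obtain ⟨s, hs⟩ := h
      exact ⟨s.1, fun t ht => by rw [hψ (show (b ∘ ψ) t = (b ∘ ψ) s from ht.trans hs.symm)]⟩
    · exact ⟨0, fun s hs => (h ⟨s, hs⟩).elim⟩
  refine ⟨fun s => ψ (c.succAbove s.1, s.2), ?_, fun s t => ?_⟩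
  · intro s t hst
    have := hψ hst
    rw [Prod.mk.injEq] at this
    exact Prod.ext (Fin.succAbove_right_injective this.1) this.2
  · have hne : ∀ s : Fin k × Fin L, b (ψ (c.succAbove s.1, s.2)) ≠ j := fun s hs =>
      Fin.succAbove_ne c s.1 (hc _ hs)
    rw [← hGG' _ _ (hne s) (hne t), ← hG, pathForest_adj, pathForest_adj]
    simp only [Fin.succAbove_right_injective.eq_iff]

section Components

variable {k L : ℕ} {K : SimpleGraph V} (e : pathForest k L ≃g K)

include e

lemma reachable_iff_fst_eq (v w : V) : K.Reachable v w ↔ (e.symm v).1 = (e.symm w).1 := by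
  constructor
  · rintro ⟨p⟩
    induction p with
    | nil => rfl
    | cons h _ ih => exact ((e.symm.map_adj_iff.2 h).1).trans ih
  · intro h
    obtain ⟨⟨a, x⟩, rfl⟩ := e.surjective v
    obtain ⟨⟨a', y⟩, rfl⟩ := e.surjective w
    simp only [RelIso.symm_apply_apply] at h
    subst h
    obtain ⟨n, rfl⟩ : ∃ n, L = n + 1 := ⟨L - 1, by have := x.2; omega⟩
    let f : pathGraph (n + 1) →g pathForest k (n + 1) := ⟨fun x => (a, x), fun h => ⟨rfl, h⟩⟩
    exact ((pathGraph_connected n x y).map f).map e.toHom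

/-- The components of a disjoint union of paths. -/
lemma exists_component_iso (C : K.ConnectedComponent) :
    Nonempty (pathGraph L ≃g C.toSimpleGraph) := by
  induction C using ConnectedComponent.ind with
  | _ v =>
  have hsupp : ∀ x, e ((e.symm v).1, x) ∈ (K.connectedComponentMk v).supp := by
    intro x
    rw [ConnectedComponent.mem_supp_iff, ConnectedComponent.eq, reachable_iff_fst_eq e]
    simp
  let f : Fin L → (K.connectedComponentMk v).supp := fun x => ⟨e ((e.symm v).1, x), hsupp x⟩
  have hf : Function.Bijective f := by
    constructor
    · intro x y h
      have := e.injective (Subtype.ext_iff.1 h)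
      exact (Prod.mk.inj this).2
    · rintro ⟨w, hw⟩
      rw [ConnectedComponent.mem_supp_iff, ConnectedComponent.eq, reachable_iff_fst_eq e] at hw
      refine ⟨(e.symm w).2, Subtype.ext ?_⟩
      simp only [f]
      rw [← hw]
      exact e.apply_symm_apply w
  refine ⟨⟨Equiv.ofBijective f hf, ?_⟩⟩
  intro x y
  change K.Adj (e _) (e _) ↔ _
  rw [e.map_adj_iff, pathForest_adj]
  simp

lemma isLinearForest_of_iso : IsLinearForest K := fun C =>
  ⟨L, (exists_component_iso e C).map fun f => f.symm⟩

lemma ncard_supp_eq_of_iso (C : K.ConnectedComponent) : C.supp.ncard = L := by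
  obtain ⟨f⟩ := exists_component_iso e C
  rw [← Nat.card_coe_set_eq]
  exact (Nat.card_congr f.toEquiv).symm.trans (by simp)

end Components

lemma HasTransversalForest.hasInducedLinearForest [Fintype V] {ι : Type*} {b : V → ι} {L : ℕ}
    {G : SimpleGraph V} {k : ℕ} (h : HasTransversalForest b L G k) {m : ℝ} (hm : m ≤ k * L) :
    HasInducedLinearForest G m L := by
  classical
  obtain ⟨ψ, hψ, hG⟩ := h
  have hinj : ψ.Injective := Function.Injective.of_comp hψ
  let U : Finset V := univ.image ψ
  let f : Fin k × Fin L → (U : Set V) := fun s => ⟨ψ s, mem_coe.2 (mem_image_of_mem ψ (mem_univ s))⟩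
  have hf : Function.Bijective f := by
    constructor
    · exact fun s t hst => hinj (Subtype.ext_iff.1 hst)
    · rintro ⟨v, hv⟩
      obtain ⟨s, -, rfl⟩ := mem_image.1 (mem_coe.1 hv)
      exact ⟨s, rfl⟩
  let e : pathForest k L ≃g G.induce (U : Set V) := ⟨Equiv.ofBijective f hf, (hG _ _).symm⟩
  refine ⟨U, ?_, isLinearForest_of_iso e, ncard_supp_eq_of_iso e⟩
  rw [card_image_of_injective _ hinj]
  simpa using hm

/-- The largest number of components of a transversal induced forest. -/
noncomputable def maxTransversalForest [Fintype V] {ι : Type*} (b : V → ι) (L : ℕ)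
    (G : SimpleGraph V) : ℕ :=
  open Classical in Nat.findGreatest (HasTransversalForest b L G) (Fintype.card V)

variable [Fintype V] {ι : Type*} {b : V → ι} {L : ℕ}

lemma hasTransversalForest_max (G : SimpleGraph V) :
    HasTransversalForest b L G (maxTransversalForest b L G) := by
  classical
  exact Nat.findGreatest_spec (P := HasTransversalForest b L G) (Nat.zero_le _)
    (hasTransversalForest_zero b L G)

/-- As L > 0, k ≤ kL ≤ |V|, so the cap in `Nat.findGreatest` excludes nothing. -/
lemma HasTransversalForest.le_max (hL : 0 < L) {G : SimpleGraph V} {k : ℕ}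
    (h : HasTransversalForest b L G k) : k ≤ maxTransversalForest b L G := by
  classical
  refine Nat.le_findGreatest ?_ h
  obtain ⟨ψ, hψ, -⟩ := h
  have := Fintype.card_le_of_injective ψ (Function.Injective.of_comp hψ)
  rw [Fintype.card_prod, Fintype.card_fin, Fintype.card_fin] at this
  nlinarith

lemma maxTransversalForest_le_add_one (hL : 0 < L) {G G' : SimpleGraph V} (j : ι)
    (hGG' : ∀ u v, b u ≠ j → b v ≠ j → (G.Adj u v ↔ G'.Adj u v)) :
    maxTransversalForest b L G ≤ maxTransversalForest b L G' + 1 := by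
  rcases h : maxTransversalForest b L G with _ | k
  · omega
  · have h1 := hasTransversalForest_max (b := b) (L := L) G
    rw [h] at h1
    exact Nat.succ_le_succ ((h1.of_changed_block j hGG').le_max hL)

end SimpleGraph

/-! ### A tail bound for the number of components -/

namespace SimpleGraph

/-- The partition of `Fin n` into intervals of length `m`. -/
def blockOf (n m : ℕ) (v : Fin n) : Fin (n / m + 1) :=
  ⟨v.val / m, Nat.lt_succ_of_le (Nat.div_le_div_right v.isLt.le)⟩

/-- A block has at most `m` vertices, so `N` forbidden blocks exclude at most N m. -/
lemma card_filter_blockOf_notMem {n m D N : ℕ} (hm : 0 < m) (hD : N * m + D ≤ n)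
    (S : Finset (Fin (n / m + 1))) (hS : S.card ≤ N) :
    D ≤ (univ.filter fun v => blockOf n m v ∉ S).card := by
  have h1 : (univ.filter fun v => blockOf n m v ∈ S).card ≤ N * m := by
    refine le_trans ?_ (Nat.mul_le_mul_right m hS)
    rw [mul_comm]
    refine card_le_mul_card_image_of_maps_to (f := blockOf n m) ?_ m ?_
    · intro v hv
      exact (mem_filter.1 hv).2
    · intro j _
      rw [← card_image_of_injective _ Fin.val_injective]
      refine (card_le_card (t := Ico (j.val * m) (j.val * m + m)) fun i hi => ?_).trans
        (by simp)
      rw [mem_image] at hi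
      obtain ⟨v, hv, rfl⟩ := hi
      have hj : v.val / m = j.val := by
        rw [← (mem_filter.1 hv).2]; rfl
      rw [mem_Ico, ← hj]
      have h1 := Nat.div_add_mod v.val m
      have h2 := Nat.mod_lt v.val hm
      rw [mul_comm] at h1
      omega
  have h2 := card_filter_add_card_filter_not (s := (univ : Finset (Fin n)))
    (fun v => blockOf n m v ∈ S)
  rw [Finset.card_univ, Fintype.card_fin] at h2
  omega

lemma transversals_blockOf_nonempty {n m N : ℕ} (hm : 0 < m) (h : N * m ≤ n) :
    (transversals (Fin N) (blockOf n m)).Nonempty := by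
  have hlt : ∀ t : Fin N, t.val * m < n := fun t =>
    (Nat.mul_lt_mul_of_pos_right t.isLt hm).trans_le h
  refine ⟨fun t => ⟨t.val * m, hlt t⟩, mem_transversals.2 fun s t hst => ?_⟩
  have := Fin.ext_iff.1 hst
  simp only [Function.comp_apply, blockOf, Nat.mul_div_cancel _ hm] at this
  exact Fin.ext this

/-- The group of a pair of vertices: the later one of its two blocks. -/
def edgeGroup (n m : ℕ) : Sym2 (Fin n) → Fin (n / m + 1) :=
  Sym2.lift ⟨fun u v => max (blockOf n m u) (blockOf n m v), fun _ _ => max_comm _ _⟩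

lemma edgeGroup_ne {n m : ℕ} {u v : Fin n} {j : Fin (n / m + 1)} (hu : blockOf n m u ≠ j)
    (hv : blockOf n m v ≠ j) : edgeGroup n m s(u, v) ≠ j := by
  change max _ _ ≠ j
  rcases max_choice (blockOf n m u) (blockOf n m v) with h | h <;> rw [h] <;> assumption

/-- The second moment bounds P(X ≥ k) below by the reciprocal of the first factor on the right, and
bounded differences over the n/m + 1 blocks supply the second factor. -/
theorem prob_maxTransversalForest_le {n m k L D : ℕ} (p : unitInterval) (hp0 : 0 < (p : ℝ))
    (hp1 : (p : ℝ) < 1) (hm : 0 < m) (hL : 0 < L) (hD0 : 0 < D) (hD : k * L * m + D ≤ n)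
    {h : ℝ} (hh : 0 ≤ h) (hr : (1 - (p : ℝ))⁻¹ ≤ Real.exp h)
    (hnp : 2 ≤ ((k * L : ℕ) : ℝ) * p) (hDp : 4 * Real.exp 1 ≤ D * p)
    (hlarge : ∀ i : ℕ, i ≤ k * L → 2 < h * i →
      4 * Real.exp 1 * ((k * L : ℕ) : ℝ) ^ 2 * Real.exp (h * i / 2) ≤ D * i)
    {t : ℝ} (ht : 0 ≤ t) :
    (binomialRandom (Fin n) p).real
        {G | (maxTransversalForest (blockOf n m) L G : ℝ) ≤ k - t} ≤
      (Real.exp (2 * Real.exp 1 * ((k * L : ℕ) : ℝ) ^ 2 / D) + 2) *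
        Real.exp (-(t ^ 2 / (2 * (n / m + 1 : ℕ)))) := by
  classical
  set R := Real.exp (2 * Real.exp 1 * ((k * L : ℕ) : ℝ) ^ 2 / D) + 2 with hR
  have hR0 : 0 < R := by positivity
  have h1 := one_le_mul_prob_exists_copy (pathForestFin_adj (k := k) (L := L)) p hp0 hp1 hD0
    (fun S hS => by convert card_filter_blockOf_notMem hm hD S hS)
    (transversals_blockOf_nonempty hm (by omega))
    (overlap_sum_le pathForestFin_adj hp0 hp1 hh hr (by exact_mod_cast hD0) hnp hDp hlarge)
  have h2 : (binomialRandom (Fin n) p).real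
      {G | ∃ ψ ∈ transversals (Fin (k * L)) (blockOf n m), G ∈ copyEvent (pathForestFin k L) ψ} ≤
      (binomialRandom (Fin n) p).real
        {G | (k : ℝ) ≤ (maxTransversalForest (blockOf n m) L G : ℝ)} := by
    refine measureReal_mono ?_
    rintro G ⟨ψ, hψ, hG⟩
    rw [Set.mem_ofPred_eq]
    exact_mod_cast (hasTransversalForest_of_copy (mem_transversals.1 hψ) hG).le_max hL
  have h3 := binomialRandom_bounded_differences p (edgeGroup n m)
    (fun G => (maxTransversalForest (blockOf n m) L G : ℝ)) (fun j G G' hGG' => by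
      have := maxTransversalForest_le_add_one (b := blockOf n m) hL j
        (fun u v hu hv => hGG' s(u, v) (edgeGroup_ne hu hv))
      exact_mod_cast this) (a := k) (Nat.succ_pos _) ht
  set Q := (binomialRandom (Fin n) p).real
    {G | (maxTransversalForest (blockOf n m) L G : ℝ) ≤ k - t} with hQ
  have hQ0 : 0 ≤ Q := measureReal_nonneg
  calc Q = 1 * Q := (one_mul Q).symm
    _ ≤ R * (binomialRandom (Fin n) p).real
        {G | (k : ℝ) ≤ (maxTransversalForest (blockOf n m) L G : ℝ)} * Q :=
        mul_le_mul_of_nonneg_right (h1.trans (mul_le_mul_of_nonneg_left h2 hR0.le)) hQ0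
    _ ≤ _ := by
        rw [mul_assoc]
        exact mul_le_mul_of_nonneg_left h3 hR0.le

end SimpleGraph

/-! ### Parameters -/

namespace SimpleGraph

lemma density_le {ε n p d : ℝ} (hn0 : 0 < n) (hd : d = n * p) (hd16 : 16 ≤ d)
    (hn : 4 * (d * √d) ≤ ε * n) : p ≤ ε / 16 := by
  have hsd4 : 4 ≤ √d := Real.le_sqrt_of_sq_le (by linarith)
  have h1 : d * 4 ≤ d * √d := mul_le_mul_of_nonneg_left hsd4 (by linarith)
  have : n * (p * 16) ≤ n * ε := by
    calc n * (p * 16) = 4 * (d * 4) := by rw [hd]; ring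
      _ ≤ 4 * (d * √d) := by linarith
      _ ≤ n * ε := by linarith
  have := le_of_mul_le_mul_left this hn0
  linarith

lemma floor_path_order {d l : ℝ} (hd0 : 0 < d) (hl1 : 1 ≤ l) (hlL : l ^ 4 ≤ √d) :
    0 < ⌊√d / l ^ 4⌋₊ ∧ (⌊√d / l ^ 4⌋₊ : ℝ) ^ 2 * l ^ 8 ≤ d ∧ (⌊√d / l ^ 4⌋₊ : ℝ) ≤ √d := by
  have hl4 : (1 : ℝ) ≤ l ^ 4 := one_le_pow₀ hl1
  have hle : (⌊√d / l ^ 4⌋₊ : ℝ) * l ^ 4 ≤ √d :=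
    (le_div_iff₀ (by positivity)).1 (Nat.floor_le (by positivity))
  refine ⟨Nat.floor_pos.2 ((one_le_div (by positivity)).2 hlL), ?_, ?_⟩
  · calc (⌊√d / l ^ 4⌋₊ : ℝ) ^ 2 * l ^ 8 = (⌊√d / l ^ 4⌋₊ * l ^ 4) ^ 2 := by ring
      _ ≤ √d ^ 2 := pow_le_pow_left₀ (by positivity) hle 2
      _ = d := Real.sq_sqrt hd0.le
  · exact (le_mul_of_one_le_right (Nat.cast_nonneg _) hl4).trans hle

/-- Ensures that rounding `k` down costs at most a quarter of ε times the number l/(pL) of paths. -/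
lemma four_le_mul_number_of_paths {ε n p d l L : ℝ} (hn0 : 0 < n) (hp0 : 0 < p) (hε : 0 < ε)
    (hd : d = n * p) (hd0 : 0 < d) (hl1 : 1 ≤ l) (hL0 : 0 < L) (hLd : L ≤ √d)
    (hn : 4 * (d * √d) ≤ ε * n) : 4 ≤ ε * (l / (p * L)) := by
  rw [mul_div_assoc', le_div_iff₀ (by positivity)]
  have : n * (4 * (p * L)) ≤ n * (ε * l) := by
    calc n * (4 * (p * L)) = 4 * (d * L) := by rw [hd]; ring
      _ ≤ 4 * (d * √d) := by gcongr
      _ ≤ ε * n * 1 := by linarith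
      _ ≤ ε * n * l := by gcongr
      _ = n * (ε * l) := by ring
  exact le_of_mul_le_mul_left this hn0

lemma floor_block_length {d l : ℝ} (hl0 : 0 < l) (hdl : l ^ 2 ≤ d) :
    0 < ⌊d / l ^ 2⌋₊ ∧ (⌊d / l ^ 2⌋₊ : ℝ) * l ^ 2 ≤ d ∧ d ≤ 2 * l ^ 2 * ⌊d / l ^ 2⌋₊ := by
  have hdl1 : 1 ≤ d / l ^ 2 := (one_le_div (by positivity)).2 hdl
  have hm0 : 0 < ⌊d / l ^ 2⌋₊ := Nat.floor_pos.2 hdl1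
  refine ⟨hm0, (le_div_iff₀ (by positivity)).1 (Nat.floor_le (by positivity)), ?_⟩
  have h1 : d / l ^ 2 - 1 < ⌊d / l ^ 2⌋₊ := Nat.sub_one_lt_floor _
  have h3 : (1 : ℝ) ≤ ⌊d / l ^ 2⌋₊ := by exact_mod_cast hm0
  have h2 : d / l ^ 2 ≤ 2 * ⌊d / l ^ 2⌋₊ := by linarith
  rw [div_le_iff₀ (by positivity)] at h2
  linarith

/-- The blocks met by one forest cover at most half of the vertices, so D ≥ n/2 remain available. -/
lemma two_mul_order_mul_length_le {n d l m N : ℝ} (hn0 : 0 < n) (hd0 : 0 < d) (hl4 : 4 ≤ l)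
    (hm0 : 0 < m) (hmle : m * l ^ 2 ≤ d) (hNd : N * d ≤ 2 * l * n) : 2 * (N * m) ≤ n := by
  have hl0 : 0 < l := by linarith
  have h1 : (2 * (N * m)) * (l * d) ≤ n * (l * d) := by
    calc (2 * (N * m)) * (l * d) = (N * d) * (2 * l * m) := by ring
      _ ≤ (2 * l * n) * (2 * l * m) := by gcongr
      _ = 4 * n * (m * l ^ 2) := by ring
      _ ≤ 4 * n * d := by gcongr
      _ ≤ l * n * d := by gcongr
      _ = n * (l * d) := by ring
  exact le_of_mul_le_mul_right h1 (by positivity)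

lemma sq_mul_sq_le {n d l N : ℝ} (hd0 : 0 < d) (hN0 : 0 ≤ N) (hNd : N * d ≤ 2 * l * n) :
    N ^ 2 * d ^ 2 ≤ 4 * l ^ 2 * n ^ 2 := by
  calc N ^ 2 * d ^ 2 = (N * d) ^ 2 := by ring
    _ ≤ (2 * l * n) ^ 2 := pow_le_pow_left₀ (by positivity) hNd 2
    _ = _ := by ring

/-- This is where the constant 2 - ε enters: h i/2 ≤ (1 + ε/8)(1 - ε/4) l ≤ (1 - ε/8) l, so the
non-edge factor is at most d^(1 - ε/8). Since h i > 2 forces i ≥ 1/p = n/d, the spare factor d^(ε/8)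
only has to beat a constant times l². -/
lemma large_overlap_le {ε n p d l D N h i : ℝ} (hε0 : 0 < ε) (hε1 : ε ≤ 1) (hn0 : 0 < n)
    (hp0 : 0 < p) (hd : d = n * p) (hd0 : 0 < d) (hl0 : 0 < l) (hdexp : Real.exp l = d)
    (hlε : 100 * l ^ 2 ≤ Real.exp (ε * l / 8)) (hD2 : n / 2 ≤ D)
    (hhp : h ≤ (1 + ε / 8) * p) (hNp : N * p ≤ (2 - ε / 2) * l)
    (hNsq : N ^ 2 * d ^ 2 ≤ 4 * l ^ 2 * n ^ 2) (hi0 : 0 ≤ i) (hiN : i ≤ N) (h2 : 2 < h * i) :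
    4 * Real.exp 1 * N ^ 2 * Real.exp (h * i / 2) ≤ D * i := by
  have he3 : Real.exp 1 ≤ 3 := Real.exp_one_lt_three.le
  have h3 : h * i / 2 ≤ l - ε * l / 8 := by
    have h31 : h * i ≤ (1 + ε / 8) * ((2 - ε / 2) * l) := by
      calc h * i ≤ (1 + ε / 8) * p * N := by gcongr
        _ = (1 + ε / 8) * (N * p) := by ring
        _ ≤ (1 + ε / 8) * ((2 - ε / 2) * l) := by gcongr
    have h32 : 0 ≤ ε * ε * l := by positivity
    linarith
  have h4 : Real.exp (h * i / 2) * Real.exp (ε * l / 8) ≤ d := by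
    rw [← Real.exp_add, ← hdexp]
    exact Real.exp_le_exp.2 (by linarith)
  have h5 : Real.exp (h * i / 2) * (100 * l ^ 2) ≤ d :=
    (mul_le_mul_of_nonneg_left hlε (Real.exp_pos _).le).trans h4
  have h6 : 1 ≤ p * i := by
    have h61 : h * i ≤ 2 * p * i := by
      gcongr
      exact hhp.trans (by gcongr; linarith)
    linarith
  have h7 : n ≤ d * i := by
    calc n = n * 1 := (mul_one n).symm
      _ ≤ n * (p * i) := by gcongr
      _ = d * i := by rw [hd]; ring
  have hD0 : 0 ≤ D := by linarith
  have h8 : (4 * Real.exp 1 * N ^ 2 * Real.exp (h * i / 2)) * d ^ 2 ≤ (D * i) * d ^ 2 := by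
    calc (4 * Real.exp 1 * N ^ 2 * Real.exp (h * i / 2)) * d ^ 2
        = 4 * Real.exp 1 * (N ^ 2 * d ^ 2) * Real.exp (h * i / 2) := by ring
      _ ≤ 4 * 3 * (4 * l ^ 2 * n ^ 2) * Real.exp (h * i / 2) := by gcongr
      _ = 48 / 100 * n ^ 2 * (Real.exp (h * i / 2) * (100 * l ^ 2)) := by ring
      _ ≤ 48 / 100 * n ^ 2 * d := by gcongr
      _ ≤ 50 / 100 * n ^ 2 * d := by gcongr; norm_num
      _ = n / 2 * d * n := by ring
      _ ≤ D * d * (d * i) := by gcongr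
      _ = (D * i) * d ^ 2 := by ring
  exact le_of_mul_le_mul_right h8 (by positivity)

/-- With e ≤ 3 and D ≥ n/2 the left side is at most 48 l² n/d², and 12288 = 48 · 256. -/
lemma moment_exponent_le {ε n d l D N : ℝ} (hn0 : 0 < n) (hd0 : 0 < d)
    (hl6 : 12288 ≤ ε ^ 2 * l ^ 6) (hD2 : n / 2 ≤ D) (hNsq : N ^ 2 * d ^ 2 ≤ 4 * l ^ 2 * n ^ 2) :
    2 * Real.exp 1 * N ^ 2 / D ≤ ε ^ 2 / 256 * (n * l ^ 8 / d ^ 2) := by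
  have he3 : Real.exp 1 ≤ 3 := Real.exp_one_lt_three.le
  rw [div_le_iff₀ (by linarith)]
  have h1 : (2 * Real.exp 1 * N ^ 2) * d ^ 2 ≤
      (ε ^ 2 / 256 * (n * l ^ 8 / d ^ 2) * D) * d ^ 2 := by
    calc (2 * Real.exp 1 * N ^ 2) * d ^ 2 = 2 * Real.exp 1 * (N ^ 2 * d ^ 2) := by ring
      _ ≤ 2 * 3 * (4 * l ^ 2 * n ^ 2) := by gcongr
      _ = 12288 * (l ^ 2 / 256 * n * (n / 2)) := by ring
      _ ≤ ε ^ 2 * l ^ 6 * (l ^ 2 / 256 * n * D) := by gcongr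
      _ = _ := by field_simp
  exact le_of_mul_le_mul_right h1 (by positivity)

/-- There are B ≤ 4nl²/d groups, and L² l⁸ ≤ d gives (l/(pL))² ≥ l¹⁰n²/d³. Long blocks are
essential: they reduce the number of groups from `n` and so gain a factor of order d/l². -/
lemma concentration_exponent_le {ε p d l L B m n : ℝ} (hn0 : 0 < n)
    (hp0 : 0 < p) (hp1 : p ≤ 1) (hd : d = n * p) (hd0 : 0 < d) (hl1 : 1 ≤ l)
    (hL0 : 0 < L) (hLsq : L ^ 2 * l ^ 8 ≤ d) (hm0 : 0 < m) (hmle : m * l ^ 2 ≤ d)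
    (hmge : d ≤ 2 * l ^ 2 * m) (hB0 : 0 < B) (hB : B ≤ n / m + 1) :
    2 * (ε ^ 2 / 256 * (n * l ^ 8 / d ^ 2)) ≤ (ε / 4 * (l / (p * L))) ^ 2 / (2 * B) := by
  have hmn : m ≤ n := by
    calc m ≤ m * l ^ 2 := le_mul_of_one_le_right hm0.le (one_le_pow₀ hl1)
      _ ≤ d := hmle
      _ ≤ n := by rw [hd]; exact mul_le_of_le_one_right hn0.le hp1
  have hB2 : B ≤ 4 * n * l ^ 2 / d := by
    have h2 : 1 ≤ n / m := (one_le_div hm0).2 hmn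
    have h3 : n / m ≤ 2 * n * l ^ 2 / d := by
      rw [div_le_div_iff₀ hm0 hd0]
      calc n * d ≤ n * (2 * l ^ 2 * m) := by gcongr
        _ = _ := by ring
    have h4 : 4 * n * l ^ 2 / d = 2 * (2 * n * l ^ 2 / d) := by ring
    linarith
  have hMsq : l ^ 10 * n ^ 2 / d ^ 3 ≤ (l / (p * L)) ^ 2 := by
    rw [div_pow, div_le_div_iff₀ (by positivity) (by positivity)]
    calc l ^ 10 * n ^ 2 * (p * L) ^ 2 = l ^ 2 * (n * p) ^ 2 * (L ^ 2 * l ^ 8) := by ring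
      _ ≤ l ^ 2 * (n * p) ^ 2 * d := by gcongr
      _ = l ^ 2 * d ^ 3 := by rw [← hd]; ring
  rw [le_div_iff₀ (by positivity)]
  calc 2 * (ε ^ 2 / 256 * (n * l ^ 8 / d ^ 2)) * (2 * B)
      ≤ 2 * (ε ^ 2 / 256 * (n * l ^ 8 / d ^ 2)) * (2 * (4 * n * l ^ 2 / d)) := by gcongr
    _ = ε ^ 2 / 16 * (l ^ 10 * n ^ 2 / d ^ 3) := by field_simp; ring
    _ ≤ ε ^ 2 / 16 * (l / (p * L)) ^ 2 := by gcongr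
    _ = _ := by ring

lemma inv_one_sub_le_exp {p : ℝ} (hp1 : p < 1) : (1 - p)⁻¹ ≤ Real.exp (p / (1 - p)) := by
  have hq : 0 < 1 - p := by linarith
  refine le_trans (le_of_eq ?_) (Real.add_one_le_exp _)
  field_simp
  ring

lemma div_one_sub_le {ε p : ℝ} (hp0 : 0 < p) (hp : p ≤ ε / 16) (hε : ε ≤ 1) :
    p / (1 - p) ≤ (1 + ε / 8) * p := by
  rw [div_le_iff₀ (by linarith)]
  have h1 : p * p ≤ p * (ε / 16) := mul_le_mul_of_nonneg_left hp hp0.le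
  have h2 : p * p * ε ≤ p * p * 1 := mul_le_mul_of_nonneg_left hε (by positivity)
  have h3 : 0 ≤ ε * p := mul_nonneg (by linarith) hp0.le
  have h4 : p * p * ε ≤ p * 1 * ε := by
    have : 0 ≤ ε := by linarith
    gcongr
    linarith
  linarith

theorem prob_not_hasInducedLinearForest_le {ε : ℝ} (hε0 : 0 < ε) (hε1 : ε ≤ 1) {n : ℕ}
    (p : unitInterval) {d l : ℝ} (hd : d = n * (p : ℝ)) (hl : l = Real.log d) (hd24 : 24 ≤ d)
    (hl4 : 4 ≤ l) (hlL : l ^ 4 ≤ √d) (hlε : 100 * l ^ 2 ≤ Real.exp (ε * l / 8))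
    (hl6 : 12288 ≤ ε ^ 2 * l ^ 6) (hn : 4 * (d * √d) ≤ ε * n) :
    (binomialRandom (Fin n) p).real {G | ¬ HasInducedLinearForest G
      ((2 - ε) * (p : ℝ)⁻¹ * l) ⌊√d / l ^ 4⌋₊} ≤
      3 * Real.exp (-(ε ^ 2 / 256 * (n * l ^ 8 / d ^ 2))) := by
  have hd0 : 0 < d := by linarith
  have hl0 : 0 < l := by linarith
  have hp0 : 0 < (p : ℝ) := by
    refine lt_of_le_of_ne p.2.1 fun h => ?_
    rw [← h, mul_zero] at hd
    linarith
  have hn0 : (0 : ℝ) < n := by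
    refine lt_of_le_of_ne (Nat.cast_nonneg n) fun h => ?_
    rw [← h, zero_mul] at hd
    linarith
  have hdexp : Real.exp l = d := by rw [hl, Real.exp_log hd0]
  have hpε := density_le hn0 hd (by linarith) hn
  have hp1 : (p : ℝ) < 1 := by linarith
  have hq : 0 < 1 - (p : ℝ) := by linarith
  obtain ⟨hL0, hLsq, hLd⟩ := floor_path_order hd0 (by linarith : 1 ≤ l) hlL
  generalize ⌊√d / l ^ 4⌋₊ = L at *
  have hLr : (0 : ℝ) < L := by exact_mod_cast hL0
  have hMε := four_le_mul_number_of_paths hn0 hp0 hε0 hd hd0 (by linarith : 1 ≤ l) hLr hLd hn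
  have hML : l / (p * L) * L = l / p := by field_simp
  have hexp2 := fun (m B : ℝ) => concentration_exponent_le (ε := ε) (m := m) (B := B)
    hn0 hp0 hp1.le hd hd0 (by linarith : 1 ≤ l) hLr hLsq
  have hM0 : 0 < l / (p * L) := by positivity
  generalize l / ((p : ℝ) * L) = M at *
  -- Of the slack ε M, one half is given up here so that large overlaps stay harmless; a quarter
  -- pays for rounding and a quarter is the deviation t.
  obtain ⟨k, hkle, hkge⟩ : ∃ k : ℕ, (k : ℝ) ≤ (2 - ε / 2) * M ∧ (2 - ε / 2) * M - 1 ≤ k :=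
    ⟨_, Nat.floor_le (mul_nonneg (by linarith) hM0.le), (Nat.sub_one_lt_floor _).le⟩
  obtain ⟨N, hN⟩ : ∃ N : ℝ, N = ((k * L : ℕ) : ℝ) := ⟨_, rfl⟩
  have hNkL : N = k * L := by rw [hN]; push_cast; ring
  have hNp : N * p ≤ (2 - ε / 2) * l := by
    calc N * p ≤ (2 - ε / 2) * M * L * p := by rw [hNkL]; gcongr
      _ = (2 - ε / 2) * (M * L * p) := by ring
      _ = (2 - ε / 2) * l := by rw [hML, div_mul_cancel₀ _ hp0.ne']
  have hNd : N * d ≤ 2 * l * n := by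
    calc N * d = N * p * n := by rw [hd]; ring
      _ ≤ (2 - ε / 2) * l * n := by gcongr
      _ ≤ 2 * l * n := by gcongr; linarith
  have hN0 : 0 ≤ N := by rw [hN]; exact Nat.cast_nonneg _
  have hNge : l ≤ N * p := by
    have h0 : ε * M ≤ 1 * M := mul_le_mul_of_nonneg_right hε1 hM0.le
    have h1 : M ≤ k := by linarith
    have h2 : M * L * p ≤ k * L * p := by gcongr
    rwa [hML, div_mul_cancel₀ _ hp0.ne', ← hNkL] at h2
  have hdl : l ^ 2 ≤ d := by
    calc l ^ 2 ≤ l ^ 4 := pow_le_pow_right₀ (by linarith) (by norm_num)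
      _ ≤ √d * 1 := by rw [mul_one]; exact hlL
      _ ≤ √d * √d := by
          have : 1 ≤ √d := Real.one_le_sqrt.2 (by linarith)
          gcongr
      _ = d := Real.mul_self_sqrt hd0.le
  obtain ⟨hm0, hmle, hmge⟩ := floor_block_length hl0 hdl
  generalize ⌊d / l ^ 2⌋₊ = m at *
  have hmr : (0 : ℝ) < m := by exact_mod_cast hm0
  have hNm : 2 * (k * L * m) ≤ n := by
    have := two_mul_order_mul_length_le hn0 hd0 hl4 hmr hmle hNd
    rw [hN] at this
    exact_mod_cast this
  obtain ⟨D, hD⟩ : ∃ D, D = n - k * L * m := ⟨_, rfl⟩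
  have hD2 : (n : ℝ) / 2 ≤ D := by
    have : n ≤ 2 * D := by omega
    have : (n : ℝ) ≤ 2 * D := by exact_mod_cast this
    linarith
  have hD0 : 0 < D := by
    have : (0 : ℝ) < D := by linarith
    exact_mod_cast this
  have hDp : 4 * Real.exp 1 ≤ D * p := by
    have : Real.exp 1 < 3 := Real.exp_one_lt_three
    calc 4 * Real.exp 1 ≤ d / 2 := by linarith
      _ = (n : ℝ) / 2 * p := by rw [hd]; ring
      _ ≤ D * p := by gcongr
  have hNsq := sq_mul_sq_le hd0 hN0 hNd
  have hh0 : 0 ≤ (p : ℝ) / (1 - p) := by positivity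
  have key := prob_maxTransversalForest_le (n := n) (m := m) (k := k) (L := L) (D := D) p hp0 hp1
    hm0 hL0 hD0 (by omega) hh0 (inv_one_sub_le_exp hp1) (by rw [← hN]; linarith) hDp
    (fun i hi h2 => by
      rw [← hN]
      exact large_overlap_le hε0 hε1 hn0 hp0 hd hd0 hl0 hdexp hlε hD2
        (div_one_sub_le hp0 hpε hε1) hNp hNsq (Nat.cast_nonneg i)
        (by rw [hN]; exact_mod_cast hi) h2)
    (show 0 ≤ ε / 4 * M by positivity)
  rw [← hN] at key
  have hsub : (binomialRandom (Fin n) p).real {G | ¬ HasInducedLinearForest G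
      ((2 - ε) * (p : ℝ)⁻¹ * l) L} ≤ (binomialRandom (Fin n) p).real
        {G | (maxTransversalForest (blockOf n m) L G : ℝ) ≤ k - ε / 4 * M} := by
    refine measureReal_mono fun G hG => ?_
    rw [Set.mem_ofPred_eq] at hG ⊢
    by_contra hlt
    refine hG ((hasTransversalForest_max G).hasInducedLinearForest (b := blockOf n m) ?_)
    push Not at hlt
    have h1 : (2 - ε) * M ≤ maxTransversalForest (blockOf n m) L G := by linarith
    calc (2 - ε) * (p : ℝ)⁻¹ * l = (2 - ε) * M * L := by
          rw [mul_assoc _ M, hML]; field_simp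
      _ ≤ _ := by gcongr
  refine hsub.trans (key.trans ?_)
  have hexp1 := moment_exponent_le hn0 hd0 hl6 hD2 hNsq
  have hexp2' := hexp2 m (n / m + 1 : ℕ) hmr hmle hmge (by positivity)
    (by push_cast; exact add_le_add_left Nat.cast_div_le _)
  have hY0 : 0 ≤ ε ^ 2 / 256 * (n * l ^ 8 / d ^ 2) := by positivity
  generalize ε ^ 2 / 256 * (n * l ^ 8 / d ^ 2) = Y at *
  -- The concentration exponent 2Y beats the second moment loss e^Y with e^(-Y) to spare.
  calc _ ≤ (Real.exp Y + 2) * Real.exp (-(2 * Y)) := by gcongr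
    _ ≤ (Real.exp Y + 2 * Real.exp Y) * Real.exp (-(2 * Y)) := by
        have := Real.one_le_exp hY0
        gcongr
        linarith
    _ = 3 * (Real.exp Y * Real.exp (-(2 * Y))) := by ring
    _ = 3 * Real.exp (-Y) := by rw [← Real.exp_add]; ring_nf

end SimpleGraph

/-! ### Asymptotics -/

lemma exists_large_degree {ε : ℝ} (hε : 0 < ε) :
    ∃ d₀ : ℝ, 0 < d₀ ∧ ∀ d, d₀ ≤ d → 24 ≤ d ∧ 4 ≤ Real.log d ∧ Real.log d ^ 4 ≤ √d ∧
      100 * Real.log d ^ 2 ≤ Real.exp (ε * Real.log d / 8) ∧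
      12288 ≤ ε ^ 2 * Real.log d ^ 6 := by
  have h1 : ∀ᶠ d : ℝ in atTop, Real.log d ^ 4 ≤ √d := by
    filter_upwards [(Real.isLittleO_pow_log_id_atTop (n := 8)).bound one_pos, eventually_ge_atTop 0]
      with d hd hd0
    refine Real.le_sqrt_of_sq_le ?_
    rw [one_mul, Real.norm_eq_abs, Real.norm_eq_abs, id, abs_of_nonneg hd0] at hd
    rw [← pow_mul]
    exact (le_abs_self _).trans hd
  have h2 : ∀ᶠ d : ℝ in atTop, 100 * Real.log d ^ 2 ≤ Real.exp (ε * Real.log d / 8) := by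
    have h := (isLittleO_pow_exp_pos_mul_atTop 2 (show 0 < ε / 8 by positivity)).bound
      (show (0 : ℝ) < 1 / 100 by norm_num)
    filter_upwards [Real.tendsto_log_atTop.eventually h] with d hd
    rw [Real.norm_eq_abs, Real.norm_eq_abs, abs_of_nonneg (sq_nonneg _), Real.abs_exp] at hd
    rw [show ε * Real.log d / 8 = ε / 8 * Real.log d by ring]
    linarith
  have h3 : ∀ᶠ d : ℝ in atTop, 12288 ≤ ε ^ 2 * Real.log d ^ 6 := by
    have h := ((tendsto_pow_atTop (α := ℝ) (n := 6) (by norm_num)).comp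
      Real.tendsto_log_atTop).const_mul_atTop (show 0 < ε ^ 2 by positivity)
    exact h.eventually_ge_atTop _
  obtain ⟨d₀, hd₀⟩ := eventually_atTop.1 ((eventually_ge_atTop (24 : ℝ)).and
    ((Real.tendsto_log_atTop.eventually_ge_atTop 4).and (h1.and (h2.and h3))))
  exact ⟨max d₀ 1, by positivity, fun d hd => hd₀ d ((le_max_left _ _).trans hd)⟩

/-- In terms of s = n^(1/16) ≥ log n, the upper bound on `d` gives d ≤ s¹⁰, so d√d ≤ s¹⁵ is below n
= s¹⁶ by a factor that grows. -/
lemma eventually_degree_bounds {ε : ℝ} (hε : 0 < ε) :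
    ∀ᶠ n : ℕ in atTop, ∀ d : ℝ, 1 ≤ Real.log d → 0 < d →
      d ≤ √(n : ℝ) * Real.log n ^ 2 →
      4 * (d * √d) ≤ ε * n ∧ Real.log n ≤ n * Real.log d ^ 8 / d ^ 2 := by
  have h1 : ∀ᶠ x : ℝ in atTop, Real.log x ≤ x ^ (1 / 16 : ℝ) := by
    filter_upwards [(isLittleO_log_rpow_atTop (show (0 : ℝ) < 1 / 16 by norm_num)).bound one_pos,
      eventually_ge_atTop 0] with x hx hx0
    rw [one_mul, Real.norm_eq_abs, Real.norm_eq_abs,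
      abs_of_nonneg (Real.rpow_nonneg hx0 _)] at hx
    exact (le_abs_self _).trans hx
  have h2 : ∀ᶠ x : ℝ in atTop, 4 / ε ≤ x ^ (1 / 16 : ℝ) :=
    (tendsto_rpow_atTop (by norm_num)).eventually_ge_atTop _
  have h3 : ∀ᶠ x : ℝ in atTop, 64 ≤ Real.log x := Real.tendsto_log_atTop.eventually_ge_atTop _
  filter_upwards [tendsto_natCast_atTop_atTop.eventually (h1.and (h2.and h3)),
    eventually_gt_atTop 0] with n ⟨hn1, hn2, hn3⟩ hn0 d hd1 hd0 hdn
  have hnr : (0 : ℝ) < n := by exact_mod_cast hn0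
  obtain ⟨s, hs⟩ : ∃ s : ℝ, s = (n : ℝ) ^ (1 / 16 : ℝ) := ⟨_, rfl⟩
  rw [← hs] at hn1 hn2
  have hs64 : 64 ≤ s := hn3.trans hn1
  have hs0 : 0 < s := by linarith
  have hsn : s ^ 16 = n := by
    rw [hs, ← Real.rpow_natCast, ← Real.rpow_mul hnr.le]
    norm_num
  have hsqrt : √(n : ℝ) = s ^ 8 := by
    rw [← hsn, show s ^ 16 = (s ^ 8) ^ 2 by ring, Real.sqrt_sq (by positivity)]
  have hlog0 : 0 < Real.log n := by linarith
  rw [hsqrt] at hdn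
  constructor
  · have hds : d ≤ s ^ 10 := by
      calc d ≤ s ^ 8 * Real.log n ^ 2 := hdn
        _ ≤ s ^ 8 * s ^ 2 := by gcongr
        _ = s ^ 10 := by ring
    have hsd : √d ≤ s ^ 5 := Real.sqrt_le_iff.2 ⟨by positivity, hds.trans (le_of_eq (by ring))⟩
    rw [div_le_iff₀ hε] at hn2
    calc 4 * (d * √d) ≤ 4 * (s ^ 10 * s ^ 5) := by gcongr
      _ = 4 * s ^ 15 := by ring
      _ ≤ s * ε * s ^ 15 := by gcongr
      _ = ε * s ^ 16 := by ring
      _ = ε * n := by rw [hsn]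
  · rw [le_div_iff₀ (by positivity)]
    -- If d ≤ n^(1/4), then n/d² is already a power of n. Otherwise log d ≥ (log n)/4, and log⁸ d
    -- outweighs the log⁴ n coming from d² ≤ n log⁴ n; log n ≥ 64 absorbs the constant 4⁸.
    rcases le_total d (s ^ 4) with hds | hds
    · calc Real.log n * d ^ 2 ≤ s * (s ^ 4) ^ 2 := by gcongr
        _ = s ^ 9 * 1 := by ring
        _ ≤ s ^ 16 * Real.log d ^ 8 := by
            have h5 : s ^ 9 ≤ s ^ 16 := pow_le_pow_right₀ (by linarith) (by norm_num)
            have h6 : 1 ≤ Real.log d ^ 8 := one_le_pow₀ hd1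
            gcongr
        _ = n * Real.log d ^ 8 := by rw [hsn]
    · have hl : Real.log n / 4 ≤ Real.log d := by
        have h5 : Real.log (s ^ 4) ≤ Real.log d := Real.log_le_log (by positivity) hds
        have h6 : Real.log n = 4 * Real.log (s ^ 4) := by
          rw [← hsn, Real.log_pow, Real.log_pow]
          push_cast
          ring
        linarith
      have h7 : (64 : ℝ) ^ 3 ≤ Real.log n ^ 3 := by gcongr
      calc Real.log n * d ^ 2 ≤ Real.log n * (s ^ 8 * Real.log n ^ 2) ^ 2 := by gcongr
        _ = s ^ 16 * Real.log n ^ 5 * 1 := by ring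
        _ ≤ s ^ 16 * Real.log n ^ 5 * (Real.log n ^ 3 / 4 ^ 8) := by
            gcongr
            rw [le_div_iff₀ (by norm_num)]
            refine le_trans ?_ h7
            norm_num
        _ = s ^ 16 * (Real.log n / 4) ^ 8 := by ring
        _ ≤ s ^ 16 * Real.log d ^ 8 := by gcongr
        _ = n * Real.log d ^ 8 := by rw [hsn]

lemma HasInducedLinearForest.mono {V : Type*} [Fintype V] {G : SimpleGraph V} {m m' : ℝ} {L : ℕ}
    (h : HasInducedLinearForest G m L) (hm : m' ≤ m) : HasInducedLinearForest G m' L := by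
  obtain ⟨U, hU, h1, h2⟩ := h
  exact ⟨U, hm.trans hU, h1, h2⟩

theorem lemma1p3 (ε : ℝ) (hε : 0 < ε) :
    ∃ d₀ : ℝ, 0 < d₀ ∧
      ∀ p : ℕ → unitInterval,
        (∀ᶠ n : ℕ in Filter.atTop,
          d₀ ≤ (n : ℝ) * (p n : ℝ) ∧
            (n : ℝ) * (p n : ℝ) ≤ Real.sqrt (n : ℝ) * Real.log (n : ℝ) ^ 2) →
        Filter.Tendsto
          (fun n : ℕ =>
            (SimpleGraph.binomialRandom (Fin n) (p n)).real
              {G : SimpleGraph (Fin n) |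
                HasInducedLinearForest G
                  ((2 - ε) * (p n : ℝ)⁻¹ * Real.log ((n : ℝ) * (p n : ℝ)))
                  ⌊Real.sqrt ((n : ℝ) * (p n : ℝ)) /
                    Real.log ((n : ℝ) * (p n : ℝ)) ^ 4⌋₊})
          Filter.atTop (nhds 1) := by
  -- The estimates need ε ≤ 1; a smaller ε only asks for a larger forest.
  obtain ⟨η, hη⟩ : ∃ η : ℝ, η = min ε 1 := ⟨_, rfl⟩
  have hη0 : 0 < η := by rw [hη]; exact lt_min hε one_pos
  have hη1 : η ≤ 1 := by rw [hη]; exact min_le_right _ _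
  have hηε : η ≤ ε := by rw [hη]; exact min_le_left _ _
  obtain ⟨d₀, hd₀, hd⟩ := exists_large_degree hη0
  refine ⟨d₀, hd₀, fun p hp => ?_⟩
  have hlim : Tendsto (fun n : ℕ => 1 - 3 * Real.exp (-(η ^ 2 / 256 * Real.log n))) atTop
      (nhds 1) := by
    have h1 : Tendsto (fun n : ℕ => η ^ 2 / 256 * Real.log n) atTop atTop :=
      (Real.tendsto_log_atTop.comp tendsto_natCast_atTop_atTop).const_mul_atTop (by positivity)
    simpa using tendsto_const_nhds.sub
      ((Real.tendsto_exp_neg_atTop_nhds_zero.comp h1).const_mul (3 : ℝ))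
  refine tendsto_of_tendsto_of_tendsto_of_le_of_le' hlim tendsto_const_nhds ?_
    (Eventually.of_forall fun n => measureReal_le_one)
  filter_upwards [hp, eventually_degree_bounds hη0] with n ⟨hn1, hn2⟩ hn
  obtain ⟨h24, hl4, hlL, hlε, hl6⟩ := hd _ hn1
  obtain ⟨h5, h6⟩ := hn _ (by linarith) (by linarith) hn2
  have key := SimpleGraph.prob_not_hasInducedLinearForest_le hη0 hη1 (p n) rfl rfl h24 hl4 hlL hlε
    hl6 h5
  set A : Set (SimpleGraph (Fin n)) := {G | HasInducedLinearForest G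
    ((2 - η) * (p n : ℝ)⁻¹ * Real.log ((n : ℝ) * (p n : ℝ)))
    ⌊√((n : ℝ) * (p n : ℝ)) / Real.log ((n : ℝ) * (p n : ℝ)) ^ 4⌋₊} with hA
  have hcompl : (SimpleGraph.binomialRandom (Fin n) (p n)).real Aᶜ =
      1 - (SimpleGraph.binomialRandom (Fin n) (p n)).real A :=
    probReal_compl_eq_one_sub (Set.toFinite A).measurableSet
  have hAc : (SimpleGraph.binomialRandom (Fin n) (p n)).real Aᶜ ≤
      3 * Real.exp (-(η ^ 2 / 256 * Real.log n)) := by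
    refine key.trans ?_
    gcongr
  calc 1 - 3 * Real.exp (-(η ^ 2 / 256 * Real.log n))
      ≤ (SimpleGraph.binomialRandom (Fin n) (p n)).real A := by linarith
    _ ≤ _ := by
        refine measureReal_mono fun G hG => HasInducedLinearForest.mono hG ?_
        have hp0 : 0 ≤ (p n : ℝ)⁻¹ := inv_nonneg.2 (p n).2.1
        gcongr
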